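/- **Setting.** For $\alpha,r\ge 0$, $k\in\mathbb R$, $t\ge1$ let $\mu_{\alpha,r}(k,t)=\frac{1}{1+(|k|t^r)^\alpha}$, $\bar\mu_\alpha=\mu_{\alpha,1}$, $\tilde\mu_\alpha=\mu_{\alpha,2}$. For $p,q\in\mathbb R$, $\mathcal B_{\alpha,p,q}$ is the space of continuous functions $\hat f:(\mathbb R\setminus\{0\})\times[1,\infty)\to\mathbb C$ such that $$\sup_{t\ge1}\sup_{k\neq0}\frac{|\hat f(k,t)|}{t^{-p}\bar\mu_\alpha(k,t)+t^{-q}\tilde\mu_\alpha(k,t)}<\infty ,$$ and $\mathcal B_{\alpha,\infty,q}$ is defined in the same way with the term $t^{-p}\bar\mu_\alpha$ omitted. Let $\mathcal V_\alpha=\mathcal B_{\alpha,\frac52,1}\times\mathcal B_{\alpha,\frac12,0}\times\mathcal B_{\alpha,\frac12,1}$. Let $\boldsymbol F=(F_1,F_2)$ be a smooth real vector field with compact support in the half-plane $\{(x,y)\in\mathbb R^2: y>1\}$. Put $\hat F_j(k,t)=\int_{\mathbb R}e^{ikx}F_j(x,t)\,dx$ and $(\hat f*\hat g)(k,t)=\frac1{2\pi}\int_{\mathbb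 R}\hat f(k-k',t)\hat g(k',t)\,dk'$. For $(\hat\omega,\hat u,\hat v)\in\mathcal V_\alpha$, with $\alpha>1$, set $$\hat Q_0=\hat u*\hat\omega+\hat F_2,\qquad \hat Q_1=\hat v*\hat\omega-\hat F_1 .$$ Let $\kappa=\sqrt{k^2-ik}$ with $\operatorname{Re}\kappa>0$, $S=|k|+\kappa$, $I_1=[1,t]$, $I_2=I_3=[t,\infty)$ and, for $z\in\{\kappa,|k|\}$, $E_1^z(\tau)=E_2^z(\tau)=\frac12e^{-z\tau}$, $E_3^z(\tau)=\frac12(e^{z\tau}-e^{-z\tau})$. For $n=1,2,3$ and $m=0,1$ the components are $$\hat\omega_{n,m}(k,t)=E_n^\kappa(t-1)\int_{I_n}f_{n,m}(k,s-1)\hat Q_m(k,s)\,ds,\qquad \hat\eta_{n,m}(k,t)=E_n^\kappa(t-1)\int_{I_n}g_{n,m}(k,s-1)\hat Q_m(k,s)\,ds,$$ $$\hat\psi_{n,m}(k,t)=E_n^{|k|}(t-1)\int_{I_n}h_{n,m}(k,s-1)\hat Q_m(k,s)\,ds,\qquad \hat\varphi_{n,m}(k,t)=E_n^{|k|}(t-1)\int_{I_n}k_{n,m}(k,s-1)\hat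 Q_m(k,s)\,ds,$$ with the kernels (functions of $k\ne 0$ and $\sigma\ge0$) $$f_{1,0}=\tfrac{ik}{\kappa}e^{\kappa\sigma}-\tfrac{S^2}{\kappa}e^{-\kappa\sigma}+2Se^{-|k|\sigma},\quad f_{2,0}=\Big(\tfrac{ik}{\kappa}-\tfrac{S^2}{\kappa}\Big)e^{-\kappa\sigma}+2Se^{-|k|\sigma},\quad f_{3,0}=\tfrac{ik}{\kappa}e^{-\kappa\sigma},$$ $$f_{1,1}=e^{\kappa\sigma}+\tfrac{S^2}{ik}e^{-\kappa\sigma}-2\tfrac{|k|S}{ik}e^{-|k|\sigma},\quad f_{2,1}=\Big(-1+\tfrac{S^2}{ik}\Big)e^{-\kappa\sigma}-2\tfrac{|k|S}{ik}e^{-|k|\sigma},\quad f_{3,1}=-e^{-\kappa\sigma},$$ $$g_{1,0}=\tfrac{\kappa}{ik}f_{1,0},\quad g_{2,0}=-\Big(1+\tfrac{S^2}{ik}\Big)e^{-\kappa\sigma}+2\tfrac{\kappa S}{ik}e^{-|k|\sigma},\quad g_{3,0}=-e^{-\kappa\sigma},$$ $$g_{1,1}=\tfrac{\kappa}{ik}f_{1,1},\quad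 g_{2,1}=\tfrac{\kappa}{ik}\Big(\Big(1+\tfrac{S^2}{ik}\Big)e^{-\kappa\sigma}-2\tfrac{|k|S}{ik}e^{-|k|\sigma}\Big),\quad g_{3,1}=\tfrac{\kappa}{ik}e^{-\kappa\sigma},$$ $$h_{1,0}=-\tfrac{ik}{|k|}e^{|k|\sigma}-\tfrac{S^2}{|k|}e^{-|k|\sigma}+2Se^{-\kappa\sigma},\quad h_{2,0}=-\Big(\tfrac{ik}{|k|}+\tfrac{S^2}{|k|}\Big)e^{-|k|\sigma}+2Se^{-\kappa\sigma},\quad h_{3,0}=-\tfrac{ik}{|k|}e^{-|k|\sigma},$$ $$h_{1,1}=-e^{|k|\sigma}+\tfrac{S^2}{ik}e^{-|k|\sigma}-2\tfrac{\kappa S}{ik}e^{-\kappa\sigma},\quad h_{2,1}=\Big(1+\tfrac{S^2}{ik}\Big)e^{-|k|\sigma}-2\tfrac{\kappa S}{ik}e^{-\kappa\sigma},\quad h_{3,1}=e^{-|k|\sigma},$$ $$k_{1,0}=-\tfrac{|k|}{ik}h_{1,0},\quad k_{2,0}=-\Big(1-\tfrac{S^2}{ik}\Big)e^{-|k|\sigma}-2\tfrac{|k|S}{ik}e^{-\kappa\sigma},\quad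 k_{3,0}=-e^{-|k|\sigma},$$ $$k_{1,1}=-\tfrac{|k|}{ik}h_{1,1},\quad k_{2,1}=\tfrac{|k|}{ik}\Big(\Big(1-\tfrac{S^2}{ik}\Big)e^{-|k|\sigma}+2\tfrac{\kappa S}{ik}e^{-\kappa\sigma}\Big),\quad k_{3,1}=\tfrac{|k|}{ik}e^{-|k|\sigma}.$$ Write $\hat\omega^\ast=\sum_{n,m}\hat\omega_{n,m}$, $\hat\eta^\ast=\sum_{n,m}\hat\eta_{n,m}$, $\hat\psi^\ast=\sum_{n,m}\hat\psi_{n,m}$, $\hat\varphi^\ast=\sum_{n,m}\hat\varphi_{n,m}$. The triple $(\hat\omega,\hat u,\hat v)\in\mathcal V_\alpha$ is called a *fixed-point solution* (of the steady Navier–Stokes equations in the half-plane with drift and force $\boldsymbol F$) if, on $(\mathbb R\setminus\{0\})\times[1,\infty)$, $$\hat\omega=\hat\omega^\ast,\qquad \hat u=-\hat\eta^\ast+\hat\varphi^\ast,\qquad \hat v=\hat\omega^\ast+\hat\psi^\ast .$$ **Proposition.** Let $\alpha>1$, $\delta>0$, and let $(\hat\omega,\hat u,\hat v)\in\mathcal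 V_\alpha$ be a fixed-point solution for a force $\boldsymbol F\in C_c^\infty(\{y>1\};\mathbb R^2)$. Then $$\begin{array}{llll} \hat\psi_{1,0}\in\mathcal B_{\alpha,\frac32-\delta,2} & \hat\psi_{1,1}\in\mathcal B_{\alpha,\frac12,3} & \hat\varphi_{1,0}\in\mathcal B_{\alpha,\frac32-\delta,2} & \hat\varphi_{1,1}\in\mathcal B_{\alpha,\frac12,3}\\ \hat\psi_{2,0}\in\mathcal B_{\alpha,\frac52,2} & \hat\psi_{2,1}\in\mathcal B_{\alpha,\frac52,3} & \hat\varphi_{2,0}\in\mathcal B_{\alpha,\frac52,2} & \hat\varphi_{2,1}\in\mathcal B_{\alpha,\frac52,3}\\ \hat\psi_{3,0}\in\mathcal B_{\alpha,\frac52,2} & \hat\psi_{3,1}\in\mathcal B_{\alpha,\frac52,3} & \hat\varphi_{3,0}\in\mathcal B_{\alpha,\frac52,2} & \hat\varphi_{3,1}\in\mathcal B_{\alpha,\frac52,3}\\ \hat\omega_{1,0}\in\mathcal B_{\alpha,\frac72,3-\delta} & \hat\omega_{1,1}\in\mathcal B_{\alpha,\frac52,1} & \hat\eta_{1,0}\in\mathcal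 B_{\alpha,\frac52,2-\delta} & \hat\eta_{1,1}\in\mathcal B_{\alpha,\frac32,0}\\ \hat\omega_{2,0}\in\mathcal B_{\alpha,\infty,3} & \hat\omega_{2,1}\in\mathcal B_{\alpha,\frac52,3} & \hat\eta_{2,0}\in\mathcal B_{\alpha,\infty,2} & \hat\eta_{2,1}\in\mathcal B_{\alpha,\frac52,3}\\ \hat\omega_{3,0}\in\mathcal B_{\alpha,\frac72,3} & \hat\omega_{3,1}\in\mathcal B_{\alpha,\frac52,3} & \hat\eta_{3,0}\in\mathcal B_{\alpha,\frac52,2} & \hat\eta_{3,1}\in\mathcal B_{\alpha,\frac32,2} \end{array}$$ -/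

import Mathlib

open scoped ContDiff

namespace WallFlow

noncomputable section

/-! ### Function spaces on the Fourier side

A function of `(k, t)` with `k ≠ 0` and `t ≥ 1` is represented by a function `ℝ → ℝ → ℂ`; its values
outside that domain play no role. -/

/-- The domain `(ℝ ∖ {0}) × [1, ∞)` of the variables `(k, t)`. -/
def domain : Set (ℝ × ℝ) := {0}ᶜ ×ˢ Set.Ici 1

/-- `μ_{α,r}(k,t) = 1 / (1 + (|k| t^r)^α)`. -/
def mu (α r k t : ℝ) : ℝ := 1 / (1 + (|k| * t ^ r) ^ α)

/-- `μ̄_α = μ_{α,1}`. -/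
def muBar (α k t : ℝ) : ℝ := mu α 1 k t

/-- `μ̃_α = μ_{α,2}`. -/
def muTilde (α k t : ℝ) : ℝ := mu α 2 k t

/-- Continuous functions on the domain whose weighted supremum norm `sup |f| / w` is finite. -/
def weightedSpace (w : ℝ → ℝ → ℝ) : Set (ℝ → ℝ → ℂ) :=
  {f | ContinuousOn (Function.uncurry f) domain ∧
    ∃ C : ℝ, ∀ t : ℝ, 1 ≤ t → ∀ k : ℝ, k ≠ 0 → ‖f k t‖ / w k t ≤ C}

/-- The space `B_{α,p,q}` with finite indices `p`, `q`. -/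
def BSpace (α p q : ℝ) : Set (ℝ → ℝ → ℂ) :=
  weightedSpace fun k t => 1 / t ^ p * muBar α k t + 1 / t ^ q * muTilde α k t

/-- The space `B_{α,∞,q}`. -/
def BSpaceInf (α q : ℝ) : Set (ℝ → ℝ → ℂ) :=
  weightedSpace fun k t => 1 / t ^ q * muTilde α k t

/-- `V_α = B_{α,5/2,1} × B_{α,1/2,0} × B_{α,1/2,1}`, for triples `(ω, u, v)`. -/
def VSpace (α : ℝ) : Set ((ℝ → ℝ → ℂ) × (ℝ → ℝ → ℂ) × (ℝ → ℝ → ℂ)) :=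
  BSpace α (5 / 2) 1 ×ˢ BSpace α (1 / 2) 0 ×ˢ BSpace α (1 / 2) 1

/-! ### Fourier transform, convolution, and the nonlinear terms -/

/-- Fourier transform in the first variable, `∫ e^{ikx} f(x, t) dx`. -/
def fourier (f : ℝ × ℝ → ℝ) (k t : ℝ) : ℂ :=
  ∫ x : ℝ, Complex.exp (Complex.I * k * x) * (f (x, t) : ℂ)

/-- Convolution in `k`, `(1 / 2π) ∫ f(k - k', t) g(k', t) dk'`. -/
def conv (f g : ℝ → ℝ → ℂ) (k t : ℝ) : ℂ :=
  1 / (2 * (Real.pi : ℂ)) * ∫ k' : ℝ, f (k - k') t * g k' t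

/-- `F` is smooth with compact support in the open half-plane `y > 1`. -/
def IsForce (F : ℝ × ℝ → ℝ × ℝ) : Prop :=
  ContDiff ℝ ∞ F ∧ HasCompactSupport F ∧ tsupport F ⊆ {z | 1 < z.2}

/-- The source terms `Q₀ = u * ω + F₂` (for `m = 0`) and `Q₁ = v * ω - F₁` (for `m = 1`) of a triple
`(ω, u, v)`; other values of `m` are not used. -/
def source (F : ℝ × ℝ → ℝ × ℝ) (W : (ℝ → ℝ → ℂ) × (ℝ → ℝ → ℂ) × (ℝ → ℝ → ℂ)) :
    ℕ → ℝ → ℝ → ℂ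
  | 0 => fun k t => conv W.2.1 W.1 k t + fourier (fun z => (F z).2) k t
  | 1 => fun k t => conv W.2.2 W.1 k t - fourier (fun z => (F z).1) k t
  | _ => fun _ _ => 0

/-! ### The linear solution operator

The kernels below carry the indices `n = 1, 2, 3` and `m = 0, 1`; other indices are not used. -/

/-- `κ = √(k² - ik)`, the root with positive real part. -/
def kappa (k : ℝ) : ℂ := ((k : ℂ) ^ 2 - Complex.I * k) ^ (1 / 2 : ℂ)

/-- `|k|` as a complex number. -/
def ak (k : ℝ) : ℂ := ((|k| : ℝ) : ℂ)

/-- `ik`. -/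
def ik (k : ℝ) : ℂ := Complex.I * k

/-- `|k| + κ`. -/
def sk (k : ℝ) : ℂ := ak k + kappa k

/-- `e^{zσ}`. -/
def ex (z : ℂ) (σ : ℝ) : ℂ := Complex.exp (z * σ)

/-- The kernels `f_{n,m}` of the vorticity `ω`. -/
def kerF (n m : ℕ) (k σ : ℝ) : ℂ :=
  match n, m with
  | 1, 0 => ik k / kappa k * ex (kappa k) σ - sk k ^ 2 / kappa k * ex (-kappa k) σ
      + 2 * sk k * ex (-ak k) σ
  | 2, 0 => (ik k / kappa k - sk k ^ 2 / kappa k) * ex (-kappa k) σ + 2 * sk k * ex (-ak k) σ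
  | 3, 0 => ik k / kappa k * ex (-kappa k) σ
  | 1, 1 => ex (kappa k) σ + sk k ^ 2 / ik k * ex (-kappa k) σ
      - 2 * (ak k * sk k / ik k) * ex (-ak k) σ
  | 2, 1 => (-1 + sk k ^ 2 / ik k) * ex (-kappa k) σ - 2 * (ak k * sk k / ik k) * ex (-ak k) σ
  | 3, 1 => -ex (-kappa k) σ
  | _, _ => 0

/-- The kernels `g_{n,m}` of `η`. -/
def kerG (n m : ℕ) (k σ : ℝ) : ℂ :=
  match n, m with
  | 1, 0 => kappa k / ik k * kerF 1 0 k σ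
  | 2, 0 => -(1 + sk k ^ 2 / ik k) * ex (-kappa k) σ
      + 2 * (kappa k * sk k / ik k) * ex (-ak k) σ
  | 3, 0 => -ex (-kappa k) σ
  | 1, 1 => kappa k / ik k * kerF 1 1 k σ
  | 2, 1 => kappa k / ik k * ((1 + sk k ^ 2 / ik k) * ex (-kappa k) σ
      - 2 * (ak k * sk k / ik k) * ex (-ak k) σ)
  | 3, 1 => kappa k / ik k * ex (-kappa k) σ
  | _, _ => 0

/-- The kernels `h_{n,m}` of `ψ`. -/
def kerH (n m : ℕ) (k σ : ℝ) : ℂ :=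
  match n, m with
  | 1, 0 => -(ik k / ak k) * ex (ak k) σ - sk k ^ 2 / ak k * ex (-ak k) σ
      + 2 * sk k * ex (-kappa k) σ
  | 2, 0 => -(ik k / ak k + sk k ^ 2 / ak k) * ex (-ak k) σ + 2 * sk k * ex (-kappa k) σ
  | 3, 0 => -(ik k / ak k) * ex (-ak k) σ
  | 1, 1 => -ex (ak k) σ + sk k ^ 2 / ik k * ex (-ak k) σ
      - 2 * (kappa k * sk k / ik k) * ex (-kappa k) σ
  | 2, 1 => (1 + sk k ^ 2 / ik k) * ex (-ak k) σ
      - 2 * (kappa k * sk k / ik k) * ex (-kappa k) σ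
  | 3, 1 => ex (-ak k) σ
  | _, _ => 0

/-- The kernels `k_{n,m}` of `φ`. -/
def kerK (n m : ℕ) (k σ : ℝ) : ℂ :=
  match n, m with
  | 1, 0 => -(ak k / ik k) * kerH 1 0 k σ
  | 2, 0 => -(1 - sk k ^ 2 / ik k) * ex (-ak k) σ - 2 * (ak k * sk k / ik k) * ex (-kappa k) σ
  | 3, 0 => -ex (-ak k) σ
  | 1, 1 => -(ak k / ik k) * kerH 1 1 k σ
  | 2, 1 => ak k / ik k * ((1 - sk k ^ 2 / ik k) * ex (-ak k) σ
      + 2 * (kappa k * sk k / ik k) * ex (-kappa k) σ)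
  | 3, 1 => ak k / ik k * ex (-ak k) σ
  | _, _ => 0

/-- The factor in front of the integral: `½ e^{-zτ}` for `n = 1, 2` and `½ (e^{zτ} - e^{-zτ})` for
`n = 3`. -/
def front (n : ℕ) (z : ℂ) (τ : ℝ) : ℂ :=
  if n = 3 then 1 / 2 * (ex z τ - ex (-z) τ) else 1 / 2 * ex (-z) τ

/-- The interval of integration: `[1, t]` for `n = 1` and `[t, ∞)` for `n = 2, 3`. -/
def range (n : ℕ) (t : ℝ) : Set ℝ := if n = 1 then Set.Icc 1 t else Set.Ici t

/-- The component `ω_{n,m}`. -/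
def omega (Q : ℕ → ℝ → ℝ → ℂ) (n m : ℕ) (k t : ℝ) : ℂ :=
  front n (kappa k) (t - 1) * ∫ s in range n t, kerF n m k (s - 1) * Q m k s

/-- The component `η_{n,m}`. -/
def eta (Q : ℕ → ℝ → ℝ → ℂ) (n m : ℕ) (k t : ℝ) : ℂ :=
  front n (kappa k) (t - 1) * ∫ s in range n t, kerG n m k (s - 1) * Q m k s

/-- The component `ψ_{n,m}`. -/
def psi (Q : ℕ → ℝ → ℝ → ℂ) (n m : ℕ) (k t : ℝ) : ℂ :=
  front n (ak k) (t - 1) * ∫ s in range n t, kerH n m k (s - 1) * Q m k s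

/-- The component `φ_{n,m}`. -/
def phi (Q : ℕ → ℝ → ℝ → ℂ) (n m : ℕ) (k t : ℝ) : ℂ :=
  front n (ak k) (t - 1) * ∫ s in range n t, kerK n m k (s - 1) * Q m k s

/-- The sum of the six components of a function. -/
def total (c : ℕ → ℕ → ℝ → ℝ → ℂ) (k t : ℝ) : ℂ :=
  ∑ m ∈ Finset.range 2, ∑ n ∈ Finset.Icc 1 3, c n m k t

/-- The linear map `(Q₀, Q₁) ↦ (ω, u, v)` with `u = -η + φ` and `v = ω + ψ`. -/
def linMap (Q : ℕ → ℝ → ℝ → ℂ) : (ℝ → ℝ → ℂ) × (ℝ → ℝ → ℂ) × (ℝ → ℝ → ℂ) :=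
  (fun k t => total (omega Q) k t,
    fun k t => -total (eta Q) k t + total (phi Q) k t,
    fun k t => total (omega Q) k t + total (psi Q) k t)

/-- `W = (ω, u, v)` lies in `V_α` and is a fixed point of the nonlinear map, as a triple of functions
on the domain. -/
def IsSolution (α : ℝ) (F : ℝ × ℝ → ℝ × ℝ)
    (W : (ℝ → ℝ → ℂ) × (ℝ → ℝ → ℂ) × (ℝ → ℝ → ℂ)) : Prop :=
  W ∈ VSpace α ∧
    ∀ k t : ℝ, (k, t) ∈ domain →
      W.1 k t = (linMap (source F W)).1 k t ∧
      W.2.1 k t = (linMap (source F W)).2.1 k t ∧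
      W.2.2 k t = (linMap (source F W)).2.2 k t

end

end WallFlow

/-!
The sources `Q₀`, `Q₁` decay much faster than the triple `(ω, u, v)` itself. A convolution of two
weights is bounded by the wider weight times the integral of the narrower one, which is of order
`1 / t` for `μ̄` and `1 / t ^ 2` for `μ̃`; together with the rapid decay of the Fourier transform of
the force this gives `Q₀ ∈ B_{α,7/2,3}` and `Q₁ ∈ B_{α,7/2,4}` (`source_mem`). From here on all
estimates are linear in the source.

Write `x = |k|` and `ρ = √(min x 1)`. The algebra of the kernels rests on `S (κ - x) = -ik`. It
shows that `S (e^{-κσ} - e^{-xσ})` is bounded uniformly in `k` (`expGap`), and that the kernels for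
`n = 1` vanish at the wall `σ = 0`: to second order for `m = 0` and to first order for `m = 1`. With
`s = σ + 1` they are therefore bounded by the growing exponential times a power of `ρ s`, as well as
by the growing exponential alone.

For `n = 1` the product of the front factor and the kernel is then of size `e^{-γ(t - s)}` times
these gains, with `γ = x` or `γ = Re κ`. For `s` before the midpoint of `[1, t]` the factor
`e^{-γ(t - 1)/2}` remains, and it converts powers of `ρ` into powers of `1 / t` and the weight at
time `1` into the weight `μ̄` (if `γ = x`) or `μ̃` (if `γ = Re κ`) at time `t` (`exists_absorb`). For
`s` after the midpoint the source is as small as at time `t`, and the integral contributes a factor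
`min t (1 / γ)`. Both parts are in `exists_head_bound`. For `m = 0` the borderline integral of
`s ^ 2 s ^ (-3)` would diverge logarithmically; interpolating between the two kernel bounds with an
exponent `θ < 1` avoids this and costs the loss `δ`.

For `n = 2, 3` the source is integrated over `[t, ∞)`, where it decreases like `s ^ (-3)`, and the
kernel contributes at worst a decaying exponential (`exists_tail_bound`). Continuity of all
components follows by dominated convergence from the same kernel bounds (`comp_continuousOn`).
-/

namespace WallFlow

open MeasureTheory Set Filter Topology

/-! ### The weights -/

section Weights

variable {α r k t : ℝ}

lemma mu_denom_pos (ht : 0 < t) : 0 < 1 + (|k| * t ^ r) ^ α := by positivity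

lemma mu_pos (ht : 0 < t) : 0 < mu α r k t := one_div_pos.2 (mu_denom_pos ht)

lemma mu_le_one (ht : 0 < t) : mu α r k t ≤ 1 := by
  rw [mu, div_le_one (mu_denom_pos ht)]
  have : 0 ≤ (|k| * t ^ r) ^ α := by positivity
  linarith

lemma mu_antitone_time {s : ℝ} (hα : 0 ≤ α) (hr : 0 ≤ r) (ht : 0 < t) (hts : t ≤ s) :
    mu α r k s ≤ mu α r k t := by
  unfold mu
  gcongr

/-- A weight loses at most a constant factor when both variables shrink by a bounded factor. -/
lemma mu_le_of_le {k' s A : ℝ} (hα : 0 ≤ α) (hA : 1 ≤ A) (ht : 0 < t) (hs : 0 < s)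
    (h : |k| * t ^ r ≤ A * (|k'| * s ^ r)) : mu α r k' s ≤ A ^ α * mu α r k t := by
  have hA' : 1 ≤ A ^ α := Real.one_le_rpow hA hα
  unfold mu
  rw [mul_one_div, div_le_div_iff₀ (mu_denom_pos hs) (mu_denom_pos ht)]
  have h1 : (|k| * t ^ r) ^ α ≤ A ^ α * (|k'| * s ^ r) ^ α := by
    rw [← Real.mul_rpow (by linarith) (by positivity)]
    exact Real.rpow_le_rpow (by positivity) h hα
  nlinarith

lemma muBar_pos (ht : 0 < t) : 0 < muBar α k t := mu_pos ht

lemma muTilde_pos (ht : 0 < t) : 0 < muTilde α k t := mu_pos ht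

lemma mu_time_one (r' : ℝ) : mu α r k 1 = mu α r' k 1 := by simp [mu]

lemma continuous_mu (hα : 0 ≤ α) (t : ℝ) (ht : 0 < t) : Continuous fun k => mu α r k t := by
  unfold mu
  refine continuous_const.div ?_ fun k => (mu_denom_pos ht).ne'
  refine continuous_const.add (Continuous.rpow_const (by fun_prop) fun k => Or.inr hα)

lemma integrable_mu_one (hα : 1 < α) : Integrable fun k => mu α r k 1 := by
  have h := (integrable_one_add_norm (E := ℝ) (μ := volume) (r := α) (by simpa using hα))
  refine (h.const_mul (2 ^ α)).mono' (continuous_mu (by linarith) 1 one_pos).aestronglyMeasurable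
    (ae_of_all _ fun k => ?_)
  rw [Real.norm_of_nonneg (mu_pos one_pos).le, Real.rpow_neg (by positivity), ← div_eq_mul_inv, mu,
    div_le_div_iff₀ (mu_denom_pos one_pos) (by positivity), Real.one_rpow, mul_one, one_mul,
    Real.norm_eq_abs]
  have h2 : (1:ℝ) ≤ 2 ^ α := Real.one_le_rpow (by norm_num) (by linarith)
  rcases le_total |k| 1 with hk | hk
  · calc (1 + |k|) ^ α ≤ 2 ^ α := by gcongr; linarith
      _ ≤ 2 ^ α * (1 + |k| ^ α) := by
        have : 0 ≤ |k| ^ α := by positivity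
        nlinarith
  · calc (1 + |k|) ^ α ≤ (2 * |k|) ^ α := by gcongr; linarith
      _ = 2 ^ α * |k| ^ α := by rw [Real.mul_rpow] <;> positivity
      _ ≤ 2 ^ α * (1 + |k| ^ α) := by gcongr; linarith

lemma mu_eq_mu_one (ht : 0 < t) : mu α r k t = mu α r (t ^ r * k) 1 := by
  simp [mu, abs_mul, abs_of_pos (Real.rpow_pos_of_pos ht r), mul_comm]

lemma integrable_mu (hα : 1 < α) (ht : 0 < t) : Integrable fun k => mu α r k t := by
  simp_rw [mu_eq_mu_one ht]
  exact (integrable_mu_one hα).comp_mul_left' (by positivity)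

lemma integral_mu (ht : 0 < t) :
    ∫ k, mu α r k t = 1 / t ^ r * ∫ k, mu α r k 1 := by
  simp_rw [mu_eq_mu_one (k := _) (t := t) ht]
  rw [Measure.integral_comp_mul_left (fun k => mu α r k 1), smul_eq_mul,
    abs_of_pos (by positivity), one_div]

/-- Of two frequencies adding up to `k`, one is at least `|k| / 2`. -/
lemma mu_mul_mu_le {r' k' : ℝ} (hα : 0 ≤ α) (ht : 0 < t) :
    mu α r (k - k') t * mu α r' k' t ≤
      2 ^ α * (mu α r k t * mu α r' k' t + mu α r (k - k') t * mu α r' k t) := by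
  have p1 : 0 < mu α r k t := mu_pos ht
  have p2 : 0 < mu α r' k t := mu_pos ht
  have p3 : 0 < mu α r (k - k') t := mu_pos ht
  have p4 : 0 < mu α r' k' t := mu_pos ht
  have h2 : (0:ℝ) < 2 ^ α := by positivity
  have habs : |k| ≤ |k - k'| + |k'| := by simpa using abs_add_le (k - k') k'
  rcases le_total |k'| |k - k'| with h | h
  · have h1 : mu α r (k - k') t ≤ 2 ^ α * mu α r k t := by
      refine mu_le_of_le hα one_le_two ht ht ?_
      rw [← mul_assoc]; gcongr; linarith
    calc _ ≤ (2 ^ α * mu α r k t) * mu α r' k' t := by gcongr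
      _ ≤ _ := by rw [mul_assoc]; gcongr; nlinarith [mul_pos p3 p2]
  · have h1 : mu α r' k' t ≤ 2 ^ α * mu α r' k t := by
      refine mu_le_of_le hα one_le_two ht ht ?_
      rw [← mul_assoc]; gcongr; linarith
    calc _ ≤ mu α r (k - k') t * (2 ^ α * mu α r' k t) := by gcongr
      _ = 2 ^ α * (mu α r (k - k') t * mu α r' k t) := by ring
      _ ≤ _ := by gcongr; nlinarith [mul_pos p1 p4]

/-- At frequencies `|k| ≥ 1 / t` the weight `μ̃` is smaller than `μ̄` by a factor `1 / t`. -/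
lemma muTilde_le_div_muBar (hα : 1 ≤ α) (ht : 1 ≤ t) (hk : 1 ≤ |k| * t) :
    muTilde α k t ≤ 2 / t * muBar α k t := by
  have ht0 : 0 < t := by linarith
  unfold muTilde muBar mu
  rw [div_mul_div_comm, mul_one, div_le_div_iff₀ (mu_denom_pos ht0)
    (mul_pos ht0 (mu_denom_pos ht0)), Real.rpow_one]
  have e : |k| * t ^ (2:ℝ) = (|k| * t) * t := by
    rw [Real.rpow_two]; ring
  have h1 : t ≤ t ^ α := by simpa using Real.rpow_le_rpow_of_exponent_le ht hα
  have h2 : 1 ≤ (|k| * t) ^ α := Real.one_le_rpow hk (by linarith)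
  rw [e, Real.mul_rpow (x := |k| * t) (by positivity) ht0.le]
  nlinarith [mul_le_mul_of_nonneg_left h1 (by linarith : 0 ≤ (|k| * t) ^ α)]

end Weights

/-! ### Convolution of weights -/

section Convolution

variable {α : ℝ}

lemma integrable_mu_mul_mu {r r' k t : ℝ} (hα : 1 < α) (ht : 0 < t) :
    Integrable fun k' => mu α r (k - k') t * mu α r' k' t := by
  refine (integrable_mu (r := r') hα ht).mono' ?_ (ae_of_all _ fun k' => ?_)
  · exact (((continuous_mu (by linarith) t ht).comp (by fun_prop : Continuous fun k' => k - k')).mul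
      (continuous_mu (by linarith) t ht)).aestronglyMeasurable
  · rw [Real.norm_of_nonneg (mul_pos (mu_pos ht) (mu_pos ht)).le]
    exact mul_le_of_le_one_left (mu_pos ht).le (mu_le_one ht)

lemma integral_mu_mul_mu_le {r r' k t : ℝ} (hα : 1 < α) (ht : 0 < t) :
    ∫ k', mu α r (k - k') t * mu α r' k' t ≤
      2 ^ α * (∫ k', mu α 1 k' 1) * (1 / t ^ r' * mu α r k t + 1 / t ^ r * mu α r' k t) := by
  have i1 := (integrable_mu (r := r') hα ht).const_mul (mu α r k t)
  have i2 := ((integrable_mu (r := r) hα ht).comp_sub_left k).mul_const (mu α r' k t)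
  calc _ ≤ ∫ k', 2 ^ α * (mu α r k t * mu α r' k' t + mu α r (k - k') t * mu α r' k t) :=
        integral_mono (integrable_mu_mul_mu hα ht) ((i1.add i2).const_mul _)
          fun k' => mu_mul_mu_le (by linarith) ht
    _ = _ := by
      rw [integral_const_mul, integral_add i1 i2, integral_const_mul, integral_mul_const,
        integral_sub_left_eq_self (fun k' => mu α r k' t), integral_mu ht, integral_mu ht]
      simp_rw [mu_time_one (α := α) (r := r) 1, mu_time_one (α := α) (r := r') 1]
      ring

/-- The convolution of the wide weight `μ̄` with the narrow weight `μ̃` has the size `1 / t ^ 2` of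
`∫ μ̃` and the shape of `μ̄`. -/
lemma integral_muBar_mul_muTilde_le {k t : ℝ} (hα : 1 < α) (ht : 1 ≤ t) :
    ∫ k', muBar α (k - k') t * muTilde α k' t ≤
      3 * 2 ^ α * (∫ k', mu α 1 k' 1) * (1 / t ^ (2:ℝ) * muBar α k t) := by
  have ht0 : 0 < t := by linarith
  have hI : 0 ≤ ∫ k', mu α 1 k' 1 := integral_nonneg fun k' => (mu_pos one_pos).le
  have h2 : (1:ℝ) ≤ 2 ^ α := Real.one_le_rpow (by norm_num) (by linarith)
  have p1 : 0 < muBar α k t := muBar_pos ht0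
  rcases le_total 1 (|k| * t) with hk | hk
  · refine (integral_mu_mul_mu_le hα ht0).trans ?_
    have h := muTilde_le_div_muBar hα.le ht hk
    have : 1 / t ^ (1:ℝ) * muTilde α k t ≤ 2 * (1 / t ^ (2:ℝ) * muBar α k t) := by
      calc _ ≤ 1 / t ^ (1:ℝ) * (2 / t * muBar α k t) := by gcongr
        _ = _ := by rw [Real.rpow_one, Real.rpow_two]; field_simp
    calc _ ≤ 2 ^ α * (∫ k', mu α 1 k' 1) *
          (1 / t ^ (2:ℝ) * muBar α k t + 2 * (1 / t ^ (2:ℝ) * muBar α k t)) := by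
          exact mul_le_mul_of_nonneg_left (add_le_add_right this _) (by positivity)
      _ = _ := by ring
  · -- at these low frequencies `μ̄` is of order one, and the integral of `μ̃` is `1 / t ^ 2`
    have hmu : 1 ≤ 2 * muBar α k t := by
      unfold muBar mu
      rw [mul_one_div, le_div_iff₀ (mu_denom_pos ht0), one_mul, Real.rpow_one]
      have := Real.rpow_le_one (by positivity) hk (by linarith : 0 ≤ α)
      linarith
    calc _ ≤ ∫ k', (2 * muBar α k t) * muTilde α k' t := by
          refine integral_mono (integrable_mu_mul_mu hα ht0)
            ((integrable_mu hα ht0).const_mul _) fun k' => ?_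
          have p2 : 0 < muTilde α k' t := muTilde_pos ht0
          exact mul_le_mul_of_nonneg_right ((mu_le_one ht0).trans hmu) p2.le
      _ = 2 * (∫ k', mu α 1 k' 1) * (1 / t ^ (2:ℝ) * muBar α k t) := by
          rw [integral_const_mul]
          unfold muTilde
          rw [integral_mu ht0]
          simp_rw [mu_time_one (α := α) (r := 2) 1]
          ring
      _ ≤ _ := by
          gcongr
          linarith

lemma integral_muTilde_mul_muBar_le {k t : ℝ} (hα : 1 < α) (ht : 1 ≤ t) :
    ∫ k', muTilde α (k - k') t * muBar α k' t ≤
      3 * 2 ^ α * (∫ k', mu α 1 k' 1) * (1 / t ^ (2:ℝ) * muBar α k t) := by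
  rw [← integral_sub_left_eq_self _ volume k]
  simpa [mul_comm] using integral_muBar_mul_muTilde_le (k := k) hα ht

end Convolution

/-! ### Membership in the function spaces -/

section Spaces

/-- The weight of the space `B_{α,p,q}`. -/
noncomputable def weight (α p q k t : ℝ) : ℝ := 1 / t ^ p * muBar α k t + 1 / t ^ q * muTilde α k t

variable {α p q : ℝ} {f : ℝ → ℝ → ℂ}

lemma weight_pos {k t : ℝ} (ht : 0 < t) : 0 < weight α p q k t := by
  have := muBar_pos (α := α) (k := k) ht
  have := muTilde_pos (α := α) (k := k) ht
  unfold weight; positivity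

lemma mem_weightedSpace_iff {w : ℝ → ℝ → ℝ} (hw : ∀ k t, 1 ≤ t → 0 < w k t) :
    f ∈ weightedSpace w ↔ ContinuousOn (Function.uncurry f) domain ∧
      ∃ C, 0 ≤ C ∧ ∀ k t, k ≠ 0 → 1 ≤ t → ‖f k t‖ ≤ C * w k t := by
  refine and_congr_right fun _ => ⟨?_, ?_⟩
  · rintro ⟨C, hC⟩
    refine ⟨max C 0, le_max_right _ _, fun k t hk ht => ?_⟩
    rw [← div_le_iff₀ (hw k t ht)]
    exact (hC t ht k hk).trans (le_max_left _ _)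
  · rintro ⟨C, -, hC⟩
    exact ⟨C, fun t ht k hk => (div_le_iff₀ (hw k t ht)).2 (hC k t hk ht)⟩

lemma mem_BSpace_iff : f ∈ BSpace α p q ↔ ContinuousOn (Function.uncurry f) domain ∧
      ∃ C, 0 ≤ C ∧ ∀ k t, k ≠ 0 → 1 ≤ t → ‖f k t‖ ≤ C * weight α p q k t :=
  mem_weightedSpace_iff fun _ _ ht => weight_pos (by linarith)

lemma mem_BSpaceInf_iff : f ∈ BSpaceInf α q ↔ ContinuousOn (Function.uncurry f) domain ∧
      ∃ C, 0 ≤ C ∧ ∀ k t, k ≠ 0 → 1 ≤ t → ‖f k t‖ ≤ C * (1 / t ^ q * muTilde α k t) :=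
  mem_weightedSpace_iff fun k t ht => by
    have := muTilde_pos (α := α) (k := k) (t := t) (by linarith)
    have : 0 < t := by linarith
    positivity

lemma one_div_rpow_le {t p q : ℝ} (ht : 1 ≤ t) (h : q ≤ p) : 1 / t ^ p ≤ 1 / t ^ q :=
  one_div_le_one_div_of_le (by positivity) (Real.rpow_le_rpow_of_exponent_le ht h)

lemma weight_mono {p' q' k t : ℝ} (ht : 1 ≤ t) (hp : p' ≤ p) (hq : q' ≤ q) :
    weight α p q k t ≤ weight α p' q' k t := by
  have := muBar_pos (α := α) (k := k) (t := t) (by linarith)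
  have := muTilde_pos (α := α) (k := k) (t := t) (by linarith)
  exact add_le_add (mul_le_mul_of_nonneg_right (one_div_rpow_le ht hp) (by linarith))
    (mul_le_mul_of_nonneg_right (one_div_rpow_le ht hq) (by linarith))

lemma rpow_mul_weight {c k t : ℝ} (ht : 0 < t) :
    t ^ c * weight α p q k t = weight α (p - c) (q - c) k t := by
  unfold weight
  rw [Real.rpow_sub ht, Real.rpow_sub ht]
  field_simp

end Spaces

/-! ### The convolution of two functions -/

section Source

variable {α : ℝ}

lemma mu_le_mu_one {r k t : ℝ} (hα : 0 ≤ α) (hr : 0 ≤ r) (ht : 1 ≤ t) :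
    mu α r k t ≤ mu α 1 k 1 :=
  (mu_antitone_time hα hr one_pos ht).trans_eq (mu_time_one _)

lemma aestronglyMeasurable_slice {f : ℝ → ℝ → ℂ} (hf : ContinuousOn (Function.uncurry f) domain)
    {t : ℝ} (ht : 1 ≤ t) : AEStronglyMeasurable (fun k => f k t) volume := by
  have h : ContinuousOn (fun k => f k t) {0}ᶜ :=
    hf.comp (f := fun k : ℝ => (k, t)) (by fun_prop) fun k hk => ⟨hk, ht⟩
  have := h.aestronglyMeasurable (μ := volume) (measurableSet_singleton 0).compl
  rwa [Measure.restrict_eq_self_of_ae_mem] at this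
  exact Measure.ae_ne volume 0

lemma ae_sub_ne_zero (k : ℝ) : ∀ᵐ k' : ℝ, k - k' ≠ 0 := by
  filter_upwards [Measure.ae_ne volume k] with k' h
  exact sub_ne_zero.2 h.symm

/-- At fixed time, a weight is dominated by a multiple of the integrable function
`1 / (1 + |k| ^ α)`. -/
lemma weight_le_rpow {p q k t : ℝ} (hα : 0 ≤ α) (ht : 1 ≤ t) :
    weight α p q k t ≤ (1 / t ^ p + 1 / t ^ q) * mu α 1 k 1 := by
  have ht0 : 0 < t := by linarith
  rw [add_mul]
  exact add_le_add (mul_le_mul_of_nonneg_left (mu_le_mu_one hα zero_le_one ht) (by positivity))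
    (mul_le_mul_of_nonneg_left (mu_le_mu_one hα zero_le_two ht) (by positivity))

lemma conv_continuousOn {p₁ q₁ p₂ q₂ : ℝ} {f g : ℝ → ℝ → ℂ} (hα : 1 < α)
    (hf : f ∈ BSpace α p₁ q₁) (hg : g ∈ BSpace α p₂ q₂) :
    ContinuousOn (Function.uncurry (conv f g)) domain := by
  obtain ⟨hfc, Cf, hCf, hf⟩ := mem_BSpace_iff.1 hf
  obtain ⟨hgc, Cg, hCg, hg⟩ := mem_BSpace_iff.1 hg
  rintro ⟨k₀, t₀⟩ ⟨hk₀, ht₀⟩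
  have ht₀ : 1 ≤ t₀ := ht₀
  -- the time-dependent constants are continuous, hence bounded near `t₀`
  set A : ℝ → ℝ := fun t => Cf * (1 / t ^ p₁ + 1 / t ^ q₁) * (Cg * (1 / t ^ p₂ + 1 / t ^ q₂)) with hA
  have hAc : ContinuousAt A t₀ := by
    have h0 : t₀ ≠ 0 := by linarith
    have hc : ∀ p : ℝ, ContinuousAt (fun t : ℝ => 1 / t ^ p) t₀ := fun p =>
      continuousAt_const.div (Real.continuousAt_rpow_const _ _ (Or.inl h0))
        (Real.rpow_pos_of_pos (by linarith) p).ne'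
    have := hc p₁; have := hc p₂; have := hc q₁; have := hc q₂
    fun_prop
  have hAev : ∀ᶠ z in 𝓝[domain] (k₀, t₀), A z.2 ≤ A t₀ + 1 := by
    have : Tendsto (fun z : ℝ × ℝ => A z.2) (𝓝[domain] (k₀, t₀)) (𝓝 (A t₀)) :=
      (ContinuousAt.comp (f := Prod.snd) (x := (k₀, t₀)) hAc continuousAt_snd).mono_left
        nhdsWithin_le_nhds
    filter_upwards [this.eventually (gt_mem_nhds (lt_add_one _))] with z hz using hz.le
  refine ContinuousWithinAt.mul continuousWithinAt_const
    (continuousWithinAt_of_dominated (bound := fun k' => (A t₀ + 1) * mu α 1 k' 1) ?_ ?_ ?_ ?_)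
  · filter_upwards [self_mem_nhdsWithin (s := domain)] with z hz
    exact ((aestronglyMeasurable_slice hfc hz.2).comp_quasiMeasurePreserving
      (quasiMeasurePreserving_sub_left volume z.1)).mul (aestronglyMeasurable_slice hgc hz.2)
  · filter_upwards [self_mem_nhdsWithin (s := domain), hAev] with ⟨k, t⟩ hz hAz
    filter_upwards [Measure.ae_ne volume 0, ae_sub_ne_zero k] with k' h1 h2
    have ht : 1 ≤ t := hz.2
    have ht0 : 0 < t := by linarith
    have m1 : 0 < mu α 1 k' 1 := mu_pos one_pos
    have b1 : ‖f (k - k') t‖ ≤ Cf * (1 / t ^ p₁ + 1 / t ^ q₁) := by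
      refine (hf _ _ h2 ht).trans (mul_le_mul_of_nonneg_left ?_ hCf)
      refine (weight_le_rpow (by linarith) ht).trans (mul_le_of_le_one_right (by positivity) ?_)
      exact mu_le_one one_pos
    have b2 : ‖g k' t‖ ≤ Cg * (1 / t ^ p₂ + 1 / t ^ q₂) * mu α 1 k' 1 := by
      rw [mul_assoc]
      exact (hg _ _ h1 ht).trans (mul_le_mul_of_nonneg_left
        (weight_le_rpow (by linarith) ht) hCg)
    calc ‖f (k - k') t * g k' t‖ ≤ (Cf * (1 / t ^ p₁ + 1 / t ^ q₁)) *
          (Cg * (1 / t ^ p₂ + 1 / t ^ q₂) * mu α 1 k' 1) := by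
          rw [norm_mul]; gcongr
      _ = A t * mu α 1 k' 1 := by rw [hA]; ring
      _ ≤ _ := by gcongr
  · exact (integrable_mu_one hα).const_mul _
  · filter_upwards [Measure.ae_ne volume 0, ae_sub_ne_zero k₀] with k' h1 h2
    refine ContinuousWithinAt.mul ?_ ?_
    · have h3 : ContinuousAt (fun z : ℝ × ℝ => z.1 - k') (k₀, t₀) := by fun_prop
      have h4 : ∀ᶠ z in 𝓝[domain] (k₀, t₀), ((z.1 - k', z.2) : ℝ × ℝ) ∈ domain := by
        filter_upwards [self_mem_nhdsWithin (s := domain),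
          (h3.eventually_ne h2).filter_mono nhdsWithin_le_nhds] with z hz h5
        exact ⟨h5, hz.2⟩
      have h6 : ContinuousWithinAt (Function.uncurry f) domain (k₀ - k', t₀) := hfc _ ⟨h2, ht₀⟩
      have h7 : Tendsto (fun z : ℝ × ℝ => ((z.1 - k', z.2) : ℝ × ℝ)) (𝓝[domain] (k₀, t₀))
          (𝓝 (k₀ - k', t₀)) :=
        (Continuous.tendsto (by fun_prop : Continuous fun z : ℝ × ℝ => ((z.1 - k', z.2) : ℝ × ℝ))
          (k₀, t₀)).mono_left nhdsWithin_le_nhds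
      exact h6.tendsto.comp (tendsto_nhdsWithin_iff.2 ⟨h7, h4⟩)
    · exact (hgc.comp (f := fun z : ℝ × ℝ => (k', z.2)) (by fun_prop)
        fun z hz => ⟨h1, hz.2⟩) _ ⟨hk₀, ht₀⟩

/-- Convolution in the frequency variable gains the factor `1 / t` or `1 / t ^ 2` of the integral
of the narrower weight. -/
lemma conv_mem {p₁ q₁ p₂ q₂ p q : ℝ} {f g : ℝ → ℝ → ℂ} (hα : 1 < α)
    (hf : f ∈ BSpace α p₁ q₁) (hg : g ∈ BSpace α p₂ q₂)
    (h₁ : p ≤ p₁ + p₂ + 1) (h₂ : p ≤ p₁ + q₂ + 2) (h₃ : p ≤ q₁ + p₂ + 2) (h₄ : q ≤ q₁ + q₂ + 2) :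
    conv f g ∈ BSpace α p q := by
  refine mem_BSpace_iff.2 ⟨conv_continuousOn hα hf hg, ?_⟩
  obtain ⟨hfc, Cf, hCf, hf⟩ := mem_BSpace_iff.1 hf
  obtain ⟨hgc, Cg, hCg, hg⟩ := mem_BSpace_iff.1 hg
  set J := ∫ k', mu α 1 k' 1 with hJ
  have hJ0 : 0 ≤ J := integral_nonneg fun k' => (mu_pos one_pos).le
  refine ⟨Cf * Cg * (8 * 2 ^ α * J), by positivity, fun k t hk ht => ?_⟩
  have ht0 : 0 < t := by linarith
  have mb : 0 < muBar α k t := muBar_pos ht0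
  have mt : 0 < muTilde α k t := muTilde_pos ht0
  have i11 := (integrable_mu_mul_mu (k := k) (r := 1) (r' := 1) hα ht0).const_mul
    (1 / t ^ p₁ * (1 / t ^ p₂))
  have i12 := (integrable_mu_mul_mu (k := k) (r := 1) (r' := 2) hα ht0).const_mul
    (1 / t ^ p₁ * (1 / t ^ q₂))
  have i21 := (integrable_mu_mul_mu (k := k) (r := 2) (r' := 1) hα ht0).const_mul
    (1 / t ^ q₁ * (1 / t ^ p₂))
  have i22 := (integrable_mu_mul_mu (k := k) (r := 2) (r' := 2) hα ht0).const_mul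
    (1 / t ^ q₁ * (1 / t ^ q₂))
  have hI := (i11.add i12).add (i21.add i22)
  have key : ‖∫ k', f (k - k') t * g k' t‖ ≤ Cf * Cg * ∫ k',
      (1 / t ^ p₁ * (1 / t ^ p₂) * (mu α 1 (k - k') t * mu α 1 k' t) +
       1 / t ^ p₁ * (1 / t ^ q₂) * (mu α 1 (k - k') t * mu α 2 k' t)) +
      (1 / t ^ q₁ * (1 / t ^ p₂) * (mu α 2 (k - k') t * mu α 1 k' t) +
       1 / t ^ q₁ * (1 / t ^ q₂) * (mu α 2 (k - k') t * mu α 2 k' t)) := by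
    rw [← integral_const_mul]
    refine norm_integral_le_of_norm_le (hI.const_mul _) ?_
    filter_upwards [Measure.ae_ne volume 0, ae_sub_ne_zero k] with k' h1 h2
    rw [norm_mul]
    calc _ ≤ (Cf * weight α p₁ q₁ (k - k') t) * (Cg * weight α p₂ q₂ k' t) :=
          mul_le_mul (hf _ _ h2 ht) (hg _ _ h1 ht) (norm_nonneg _)
            (mul_nonneg hCf (weight_pos ht0).le)
      _ = _ := by unfold weight muBar muTilde; ring
  have hsplit := (integral_add (i11.add i12) (i21.add i22)).trans
    (congrArg₂ (· + ·) (integral_add i11 i12) (integral_add i21 i22))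
  simp only [Pi.add_apply] at hsplit
  rw [hsplit, integral_const_mul, integral_const_mul, integral_const_mul, integral_const_mul] at key
  have c11 := integral_mu_mul_mu_le (r := 1) (r' := 1) (k := k) hα ht0
  have c22 := integral_mu_mul_mu_le (r := 2) (r' := 2) (k := k) hα ht0
  have c12 := integral_muBar_mul_muTilde_le (k := k) hα ht
  have c21 := integral_muTilde_mul_muBar_le (k := k) hα ht
  have comb : ∀ {a b c d X m K : ℝ}, d ≤ a + b + c → 0 ≤ K → 0 ≤ m → X ≤ K * (1 / t ^ c * m) →
      1 / t ^ a * (1 / t ^ b) * X ≤ K * (1 / t ^ d * m) := by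
    intro a b c d X m K h hK hm hX
    calc _ ≤ 1 / t ^ a * (1 / t ^ b) * (K * (1 / t ^ c * m)) := by gcongr
      _ = K * (1 / t ^ (a + b + c) * m) := by
        rw [Real.rpow_add ht0, Real.rpow_add ht0]; field_simp
      _ ≤ _ := by
        gcongr K * (?_ * m)
        exact one_div_rpow_le ht h
  have hP : 0 ≤ 2 ^ α * J := by positivity
  have e11 := comb (K := 2 * (2 ^ α * J)) h₁ (by positivity) mb.le
    (c11.trans_eq (by unfold muBar; ring))
  have e22 := comb (K := 2 * (2 ^ α * J)) h₄ (by positivity) mt.le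
    (c22.trans_eq (by unfold muTilde; ring))
  have e12 := comb (K := 3 * (2 ^ α * J)) h₂ (by positivity) mb.le (c12.trans_eq (by ring))
  have e21 := comb (K := 3 * (2 ^ α * J)) h₃ (by positivity) mb.le (c21.trans_eq (by ring))
  unfold muBar muTilde at e12 e21
  have hpi : ‖(1 / (2 * (Real.pi : ℂ)))‖ ≤ 1 := by
    rw [norm_div, norm_one, norm_mul, Complex.norm_ofNat, Complex.norm_real,
      Real.norm_of_nonneg Real.pi_pos.le, div_le_one (by positivity)]
    linarith [Real.pi_gt_three]
  calc ‖conv f g k t‖ ≤ 1 * ‖∫ k', f (k - k') t * g k' t‖ := by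
        rw [conv, norm_mul]; gcongr
    _ ≤ _ := (one_mul _).trans_le key
    _ ≤ Cf * Cg * ((8 * (2 ^ α * J)) * (1 / t ^ p * muBar α k t) +
          (8 * (2 ^ α * J)) * (1 / t ^ q * muTilde α k t)) := by
        refine mul_le_mul_of_nonneg_left ?_ (by positivity)
        unfold muBar muTilde at *
        have : 0 ≤ 2 ^ α * J * (1 / t ^ q * mu α 2 k t) := by positivity
        linarith
    _ = _ := by unfold weight; ring

/-! ### The Fourier transform of the force -/

lemma exists_support_bound {G : ℝ × ℝ → ℝ} (hG : HasCompactSupport G) :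
    ∃ R : ℝ, 1 ≤ R ∧ ∀ x t, (R < |x| ∨ R < |t|) → G (x, t) = 0 := by
  obtain ⟨R, hR⟩ := hG.isCompact.isBounded.subset_closedBall 0
  refine ⟨max R 1, le_max_right _ _, fun x t h => ?_⟩
  by_contra hne
  have := hR (subset_tsupport _ hne)
  rw [mem_closedBall_zero_iff, Prod.norm_def] at this
  simp only [Real.norm_eq_abs] at this
  have h1 := (le_max_left _ _).trans this
  have h2 := (le_max_right _ _).trans this
  rcases h with h | h
  · exact absurd (h1.trans (le_max_left R 1)) (not_le.2 h)
  · exact absurd (h2.trans (le_max_left R 1)) (not_le.2 h)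

lemma norm_exp_I_mul (k x : ℝ) : ‖Complex.exp (Complex.I * k * x)‖ = 1 := by
  rw [mul_assoc, mul_comm, ← Complex.ofReal_mul]
  exact Complex.norm_exp_ofReal_mul_I _

lemma norm_fourier_integrand_le {G : ℝ × ℝ → ℝ} {R M : ℝ}
    (hR : ∀ x t, (R < |x| ∨ R < |t|) → G (x, t) = 0) (hM : ∀ z, ‖G z‖ ≤ M) (k t x : ℝ) :
    ‖Complex.exp (Complex.I * k * x) * (G (x, t) : ℂ)‖ ≤ (Icc (-R) R).indicator (fun _ => M) x := by
  rw [norm_mul, norm_exp_I_mul, one_mul, Complex.norm_real]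
  by_cases hx : x ∈ Icc (-R) R
  · rw [indicator_of_mem hx]; exact hM _
  · rw [indicator_of_notMem hx, hR x t (Or.inl ?_), norm_zero]
    rw [mem_Icc, ← abs_le] at hx
    exact not_le.1 hx

lemma fourier_bounded {G : ℝ × ℝ → ℝ} (hG : Continuous G) (hGs : HasCompactSupport G) :
    ∃ C, ∀ k t, ‖fourier G k t‖ ≤ C := by
  obtain ⟨R, -, hR⟩ := exists_support_bound hGs
  obtain ⟨M, hM⟩ := hG.bounded_above_of_compact_support hGs
  exact ⟨_, fun k t => norm_integral_le_of_norm_le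
    ((integrable_indicator_iff measurableSet_Icc).2 (by simp))
    (ae_of_all _ (norm_fourier_integrand_le hR hM k t))⟩

lemma fourier_continuous {G : ℝ × ℝ → ℝ} (hG : Continuous G) (hGs : HasCompactSupport G) :
    Continuous (Function.uncurry (fourier G)) := by
  obtain ⟨R, -, hR⟩ := exists_support_bound hGs
  obtain ⟨M, hM⟩ := hG.bounded_above_of_compact_support hGs
  refine continuous_of_dominated (bound := (Icc (-R) R).indicator fun _ => M) (fun z => ?_)
    (fun z => ae_of_all _ (norm_fourier_integrand_le hR hM z.1 z.2))
    ((integrable_indicator_iff measurableSet_Icc).2 (by simp)) (ae_of_all _ fun x => ?_)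
  · exact Continuous.aestronglyMeasurable (by fun_prop)
  · fun_prop

/-- Differentiation in the first variable becomes multiplication by `-ik`. -/
lemma fourier_fderiv {G : ℝ × ℝ → ℝ} (hG : ContDiff ℝ ∞ G) (hGs : HasCompactSupport G) (k t : ℝ) :
    fourier (fun z => fderiv ℝ G z (1, 0)) k t = -(Complex.I * k * fourier G k t) := by
  have hGc := hG.continuous
  have hd : Differentiable ℝ G := hG.differentiable (by simp)
  have hc' : Continuous fun z => fderiv ℝ G z (1, 0) :=
    (hG.continuous_fderiv (by simp)).clm_apply continuous_const
  have hs' : HasCompactSupport fun z => fderiv ℝ G z (1, 0) := hGs.fderiv_apply ℝ _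
  have integ : ∀ (H : ℝ × ℝ → ℝ) (u : ℝ → ℂ), Continuous H → HasCompactSupport H → Continuous u →
      Integrable fun x : ℝ => u x * (H (x, t) : ℂ) := by
    intro H u hH hHs hu
    refine Continuous.integrable_of_hasCompactSupport (by fun_prop) ?_
    obtain ⟨R, -, hR⟩ := exists_support_bound hHs
    refine HasCompactSupport.of_support_subset_isCompact (isCompact_Icc (a := -R) (b := R)) ?_
    intro x hx
    rw [mem_Icc, ← abs_le]
    by_contra h
    exact hx (by simp [hR x t (Or.inl (not_le.1 h))])
  have hu : ∀ x : ℝ, HasDerivAt (fun x : ℝ => Complex.exp (Complex.I * k * x))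
      (Complex.I * k * Complex.exp (Complex.I * k * x)) x := by
    intro x
    have h1 : HasDerivAt (fun x : ℝ => Complex.I * k * (x : ℂ)) (Complex.I * k * 1) x :=
      (Complex.ofRealCLM.hasDerivAt (x := x)).const_mul _
    simpa [mul_comm] using h1.cexp
  have hv : ∀ x : ℝ, HasDerivAt (fun x : ℝ => ((G (x, t) : ℝ) : ℂ))
      ((fderiv ℝ G (x, t) (1, 0) : ℝ) : ℂ) x := by
    intro x
    have h1 : HasDerivAt (fun x : ℝ => (x, t)) ((1 : ℝ), (0 : ℝ)) x :=
      (hasDerivAt_id x).prodMk (hasDerivAt_const x t)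
    exact ((hd (x, t)).hasFDerivAt.comp_hasDerivAt x h1).ofReal_comp
  unfold fourier
  rw [integral_mul_deriv_eq_deriv_mul_of_integrable (fun x _ => hu x) (fun x _ => hv x)
    (integ _ _ hc' hs' (by fun_prop)) (integ G _ hGc hGs (by fun_prop))
    (integ G _ hGc hGs (by fun_prop)), ← integral_const_mul]
  simp_rw [mul_assoc]

lemma fourier_decay (N : ℕ) : ∀ {G : ℝ × ℝ → ℝ}, ContDiff ℝ ∞ G → HasCompactSupport G →
    ∃ C, ∀ k t, |k| ^ N * ‖fourier G k t‖ ≤ C := by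
  induction N with
  | zero =>
    intro G hG hGs
    simpa using fourier_bounded hG.continuous hGs
  | succ N ih =>
    intro G hG hGs
    have h1 : ContDiff ℝ ∞ fun z => fderiv ℝ G z (1, 0) :=
      (hG.fderiv_right (by simp)).clm_apply contDiff_const
    obtain ⟨C, hC⟩ := ih h1 (hGs.fderiv_apply ℝ _)
    refine ⟨C, fun k t => ?_⟩
    have := hC k t
    rw [fourier_fderiv hG hGs] at this
    simpa [pow_succ, mul_assoc] using this

lemma fourier_mem {p q : ℝ} {G : ℝ × ℝ → ℝ} (hα : 0 ≤ α) (hG : ContDiff ℝ ∞ G)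
    (hGs : HasCompactSupport G) : fourier G ∈ BSpace α p q := by
  refine mem_BSpace_iff.2 ⟨(fourier_continuous hG.continuous hGs).continuousOn, ?_⟩
  obtain ⟨R, hR1, hR⟩ := exists_support_bound hGs
  obtain ⟨C₀, hC₀⟩ := fourier_decay 0 hG hGs
  obtain ⟨C₁, hC₁⟩ := fourier_decay ⌈α⌉₊ hG hGs
  have hR0 : 0 < R := by linarith
  have h00 : 0 ≤ C₀ := le_trans (by positivity) (hC₀ 0 0)
  have h01 : 0 ≤ C₁ := le_trans (by positivity) (hC₁ 0 0)
  refine ⟨R ^ |p| * (C₀ + R ^ α * (C₀ + C₁)), by positivity, fun k t hk ht => ?_⟩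
  have ht0 : 0 < t := by linarith
  rcases lt_or_ge R t with h | h
  · have : fourier G k t = 0 := by
      simp [fourier, hR _ t (Or.inr (h.trans_le (le_abs_self t)))]
    rw [this, norm_zero]
    have := weight_pos (α := α) (p := p) (q := q) (k := k) ht0
    positivity
  · have hk0 : 0 < |k| := abs_pos.2 hk
    have b0 := hC₀ k t
    rw [pow_zero, one_mul] at b0
    have b1 : |k| ^ α * ‖fourier G k t‖ ≤ C₀ + C₁ := by
      rcases le_total |k| 1 with h1 | h1
      · calc _ ≤ 1 * ‖fourier G k t‖ := by
              gcongr; exact Real.rpow_le_one hk0.le h1 hα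
          _ ≤ _ := by linarith
      · calc _ ≤ |k| ^ ⌈α⌉₊ * ‖fourier G k t‖ := by
              gcongr
              rw [← Real.rpow_natCast]
              exact Real.rpow_le_rpow_of_exponent_le h1 (Nat.le_ceil α)
          _ ≤ _ := by linarith [hC₁ k t]
    have b2 : ‖fourier G k t‖ ≤ (C₀ + R ^ α * (C₀ + C₁)) * muBar α k t := by
      unfold muBar mu
      rw [mul_one_div, le_div_iff₀ (mu_denom_pos ht0), Real.rpow_one, Real.mul_rpow hk0.le ht0.le]
      have : t ^ α ≤ R ^ α := by gcongr
      calc _ = ‖fourier G k t‖ + t ^ α * (|k| ^ α * ‖fourier G k t‖) := by ring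
        _ ≤ _ := by gcongr
    have b3 : 1 ≤ R ^ |p| * (1 / t ^ p) := by
      rw [mul_one_div, one_le_div (by positivity)]
      exact (Real.rpow_le_rpow_of_exponent_le ht (le_abs_self p)).trans (by gcongr)
    have mb := muBar_pos (α := α) (k := k) ht0
    have mt := muTilde_pos (α := α) (k := k) ht0
    calc _ ≤ _ := b2
      _ ≤ (R ^ |p| * (1 / t ^ p)) * ((C₀ + R ^ α * (C₀ + C₁)) * muBar α k t) :=
        le_mul_of_one_le_left (by positivity) b3
      _ = (R ^ |p| * (C₀ + R ^ α * (C₀ + C₁))) * (1 / t ^ p * muBar α k t) := by ring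
      _ ≤ _ := by
        gcongr
        exact le_add_of_nonneg_right (by positivity)

lemma add_mem_BSpace {p q : ℝ} {f g : ℝ → ℝ → ℂ} (hf : f ∈ BSpace α p q) (hg : g ∈ BSpace α p q) :
    (fun k t => f k t + g k t) ∈ BSpace α p q := by
  rw [mem_BSpace_iff] at *
  obtain ⟨hfc, C, hC0, hC⟩ := hf
  obtain ⟨hgc, D, hD0, hD⟩ := hg
  refine ⟨hfc.add hgc, C + D, by positivity, fun k t hk ht => (norm_add_le _ _).trans ?_⟩
  rw [add_mul]
  exact add_le_add (hC k t hk ht) (hD k t hk ht)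

lemma mul_mem_BSpace {p q : ℝ} {f : ℝ → ℝ → ℂ} {c : ℝ → ℂ} (hc : ContinuousOn c {0}ᶜ)
    (hc1 : ∀ k, ‖c k‖ ≤ 1) (hf : f ∈ BSpace α p q) : (fun k t => c k * f k t) ∈ BSpace α p q := by
  rw [mem_BSpace_iff] at *
  obtain ⟨hfc, C, hC0, hC⟩ := hf
  refine ⟨(hc.comp continuousOn_fst fun z hz => hz.1).mul hfc, C, hC0, fun k t hk ht => ?_⟩
  rw [norm_mul]
  exact (mul_le_of_le_one_left (norm_nonneg _) (hc1 k)).trans (hC k t hk ht)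

/-- The sources decay much faster than the triple they are built from. -/
lemma source_mem (hα : 1 < α) {F : ℝ × ℝ → ℝ × ℝ} (hF : IsForce F)
    {W : (ℝ → ℝ → ℂ) × (ℝ → ℝ → ℂ) × (ℝ → ℝ → ℂ)} (hW : W ∈ VSpace α) :
    source F W 0 ∈ BSpace α (7 / 2) 3 ∧ source F W 1 ∈ BSpace α (7 / 2) 4 := by
  obtain ⟨hF1, hF2, -⟩ := hF
  obtain ⟨hω, hu, hv⟩ := hW
  have f1 : fourier (fun z => (F z).1) ∈ BSpace α (7 / 2) 4 :=
    fourier_mem (by linarith) hF1.fst (hF2.comp_left (g := Prod.fst) rfl)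
  have f2 : fourier (fun z => (F z).2) ∈ BSpace α (7 / 2) 3 :=
    fourier_mem (by linarith) hF1.snd (hF2.comp_left (g := Prod.snd) rfl)
  refine ⟨add_mem_BSpace (conv_mem hα hu hω ?_ ?_ ?_ ?_) f2, ?_⟩
  any_goals norm_num
  have f3 := mul_mem_BSpace (c := fun _ => -1) continuousOn_const (by simp) f1
  have := add_mem_BSpace (conv_mem (p := 7 / 2) (q := 4) hα hv hω ?_ ?_ ?_ ?_) f3
  any_goals norm_num
  simpa [source, sub_eq_add_neg] using this

end Source

/-! ### Elementary bounds for the exponential -/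

section Exponential

lemma norm_ex (z : ℂ) (σ : ℝ) : ‖ex z σ‖ = Real.exp (z.re * σ) := by
  simp [ex, Complex.norm_exp]

lemma norm_exp_sub_exp_le {a b : ℂ} {m : ℝ} (ha : a.re ≤ m) (hb : b.re ≤ m) :
    ‖Complex.exp a - Complex.exp b‖ ≤ Real.exp m * ‖a - b‖ :=
  Convex.norm_image_sub_le_of_norm_hasDerivWithin_le (s := {z : ℂ | z.re ≤ m})
    (fun z _ => (Complex.hasDerivAt_exp z).hasDerivWithinAt)
    (fun z hz => by rw [Complex.norm_exp]; exact Real.exp_le_exp.2 hz)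
    (convex_halfSpace_re_le m) hb ha

lemma norm_exp_sub_one_sub_le {z : ℂ} {m : ℝ} (hz : z.re ≤ m) (hm : 0 ≤ m) :
    ‖Complex.exp z - 1 - z‖ ≤ Real.exp m * ‖z‖ ^ 2 := by
  have h := Convex.norm_image_sub_le_of_norm_hasDerivWithin_le
    (s := {w : ℂ | w.re ≤ m} ∩ Metric.closedBall 0 ‖z‖) (C := Real.exp m * ‖z‖)
    (f := fun w => Complex.exp w - w) (f' := fun w => Complex.exp w - 1) (x := 0) (y := z)
    (fun w _ => ((Complex.hasDerivAt_exp w).sub (hasDerivAt_id w)).hasDerivWithinAt) ?_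
    ((convex_halfSpace_re_le m).inter (convex_closedBall 0 _)) (by simpa using hm) (by simpa using hz)
  · have e : Complex.exp z - z - (Complex.exp 0 - 0) = Complex.exp z - 1 - z := by
      rw [Complex.exp_zero]; ring
    rw [e, sub_zero] at h
    calc _ ≤ _ := h
      _ = _ := by ring
  · rintro w ⟨hw, hwz⟩
    have := norm_exp_sub_exp_le (a := w) (b := 0) hw (by simpa using hm)
    rw [Complex.exp_zero, sub_zero] at this
    exact this.trans (by gcongr; simpa using hwz)

/-- Third-order cancellation in `2 sinh z - 2 z`, of which only two orders are used. -/
lemma norm_exp_sub_exp_neg_sub_le {z : ℂ} (hz : 0 ≤ z.re) :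
    ‖Complex.exp z - Complex.exp (-z) - 2 * z‖ ≤ 2 * ‖z‖ ^ 2 * Real.exp z.re := by
  have h1 := norm_exp_sub_one_sub_le (le_refl z.re) hz
  have h2 := norm_exp_sub_one_sub_le (z := -z) (m := z.re) (by simp; linarith) hz
  rw [norm_neg] at h2
  calc _ = ‖(Complex.exp z - 1 - z) - (Complex.exp (-z) - 1 - -z)‖ := by congr 1; ring
    _ ≤ _ := norm_sub_le _ _
    _ ≤ _ := by linarith

lemma mul_exp_neg_le_one (y : ℝ) : y * Real.exp (-y) ≤ 1 := by
  rw [Real.exp_neg, ← div_eq_mul_inv, div_le_one (Real.exp_pos y)]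
  linarith [Real.add_one_le_exp y]

end Exponential

/-! ### The root `κ` -/

section Kappa

variable {k : ℝ}

lemma kappa_sq (k : ℝ) : kappa k ^ 2 = (k : ℂ) ^ 2 - Complex.I * k := by
  simp [kappa]

lemma ak_sq (k : ℝ) : ak k ^ 2 = (k : ℂ) ^ 2 := by
  rw [ak, ← Complex.ofReal_pow, sq_abs, Complex.ofReal_pow]

lemma kappa_sq_eq (k : ℝ) : kappa k ^ 2 = ak k ^ 2 - ik k := by
  rw [kappa_sq, ak_sq, ik]

lemma slitPlane_of_ne_zero (hk : k ≠ 0) : (k : ℂ) ^ 2 - Complex.I * k ∈ Complex.slitPlane := by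
  refine Or.inr ?_
  simpa [pow_two] using hk

lemma kappa_re_pos (hk : k ≠ 0) : 0 < (kappa k).re := by
  have hs := slitPlane_of_ne_zero hk
  have h0 := Complex.slitPlane_ne_zero hs
  have harg := Complex.mem_slitPlane_iff_arg.1 hs
  rw [kappa, Complex.cpow_def_of_ne_zero h0, Complex.exp_re]
  refine mul_pos (Real.exp_pos _) (Real.cos_pos_of_mem_Ioo ?_)
  have e : (Complex.log ((k : ℂ) ^ 2 - Complex.I * k) * (1 / 2 : ℂ)).im =
      Complex.arg ((k : ℂ) ^ 2 - Complex.I * k) / 2 := by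
    rw [show (1 / 2 : ℂ) = ((1 / 2 : ℝ) : ℂ) by norm_num, Complex.im_mul_ofReal, Complex.log_im]
    ring
  rw [e]
  have h1 := Complex.neg_pi_lt_arg ((k : ℂ) ^ 2 - Complex.I * k)
  have h2 := lt_of_le_of_ne (Complex.arg_le_pi ((k : ℂ) ^ 2 - Complex.I * k)) harg.1
  constructor <;> linarith

lemma kappa_re_sq_sub (k : ℝ) : (kappa k).re ^ 2 - (kappa k).im ^ 2 = |k| ^ 2 := by
  have := congrArg Complex.re (kappa_sq k)
  simp [pow_two] at this ⊢
  exact this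

lemma norm_kappa_sq (k : ℝ) : ‖kappa k‖ ^ 2 = (kappa k).re ^ 2 + (kappa k).im ^ 2 := by
  rw [← Complex.normSq_eq_norm_sq, Complex.normSq_apply]; ring

lemma norm_kappa_pow_four (k : ℝ) : (‖kappa k‖ ^ 2) ^ 2 = |k| ^ 4 + |k| ^ 2 := by
  have h1 : ‖kappa k‖ ^ 2 = ‖(k : ℂ) ^ 2 - Complex.I * k‖ := by rw [← norm_pow, kappa_sq]
  rw [h1, ← Complex.normSq_eq_norm_sq, Complex.normSq_apply]
  simp [pow_two]
  have : |k| ^ 4 = k ^ 4 := by rw [show 4 = 2 * 2 from rfl, pow_mul, sq_abs, ← pow_mul]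
  rw [this]; ring

lemma abs_le_kappa_re (hk : k ≠ 0) : |k| ≤ (kappa k).re := by
  refine abs_le_of_sq_le_sq' ?_ (kappa_re_pos hk).le |>.2
  nlinarith [kappa_re_sq_sub k, sq_nonneg (kappa k).im]

lemma abs_le_norm_kappa_sq (k : ℝ) : |k| ≤ ‖kappa k‖ ^ 2 := by
  refine abs_le_of_sq_le_sq' ?_ (by positivity) |>.2
  rw [norm_kappa_pow_four]
  nlinarith [pow_nonneg (abs_nonneg k) 4]

lemma norm_kappa_sq_le (k : ℝ) : ‖kappa k‖ ^ 2 ≤ |k| * (1 + |k|) := by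
  have := abs_nonneg k
  refine abs_le_of_sq_le_sq' ?_ (by positivity) |>.2
  rw [norm_kappa_pow_four]
  nlinarith [pow_nonneg (abs_nonneg k) 3]

lemma kappa_re_le_norm (k : ℝ) : (kappa k).re ≤ ‖kappa k‖ := Complex.re_le_norm _

lemma abs_le_norm_kappa (hk : k ≠ 0) : |k| ≤ ‖kappa k‖ :=
  (abs_le_kappa_re hk).trans (kappa_re_le_norm k)

lemma norm_kappa_le (k : ℝ) : ‖kappa k‖ ≤ 1 + |k| := by
  have := abs_nonneg k
  refine abs_le_of_sq_le_sq' ?_ (by positivity) |>.2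
  nlinarith [norm_kappa_sq_le k]

lemma norm_kappa_le_two_mul_re (hk : k ≠ 0) : ‖kappa k‖ ≤ 2 * (kappa k).re := by
  have h := kappa_re_pos hk
  refine abs_le_of_sq_le_sq' ?_ (by positivity) |>.2
  nlinarith [norm_kappa_sq k, kappa_re_sq_sub k, sq_nonneg |k|]

lemma norm_kappa_pos (hk : k ≠ 0) : 0 < ‖kappa k‖ := (kappa_re_pos hk).trans_le (kappa_re_le_norm k)

lemma kappa_ne_zero (hk : k ≠ 0) : kappa k ≠ 0 := norm_pos_iff.1 (norm_kappa_pos hk)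

lemma ik_ne_zero (hk : k ≠ 0) : ik k ≠ 0 :=
  mul_ne_zero Complex.I_ne_zero (Complex.ofReal_ne_zero.2 hk)

lemma ak_ne_zero (hk : k ≠ 0) : ak k ≠ 0 := Complex.ofReal_ne_zero.2 (abs_ne_zero.2 hk)

lemma norm_ik (k : ℝ) : ‖ik k‖ = |k| := by simp [ik]

lemma norm_ak (k : ℝ) : ‖ak k‖ = |k| := by simp [ak]

lemma ak_re (k : ℝ) : (ak k).re = |k| := by simp [ak]

lemma norm_sk_le (hk : k ≠ 0) : ‖sk k‖ ≤ 2 * ‖kappa k‖ := by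
  have := norm_add_le (ak k) (kappa k)
  rw [norm_ak] at this
  unfold sk
  linarith [abs_le_norm_kappa hk]

lemma sk_mul_sub (k : ℝ) : sk k * (kappa k - ak k) = -ik k := by
  unfold sk
  linear_combination kappa_sq_eq k

lemma sk_sq_eq_ak (k : ℝ) : sk k ^ 2 = 2 * (ak k * sk k) - ik k := by
  unfold sk
  linear_combination kappa_sq_eq k

lemma sk_sq_eq_kappa (k : ℝ) : sk k ^ 2 = 2 * (kappa k * sk k) + ik k := by
  unfold sk
  linear_combination -kappa_sq_eq k

/-- The low-frequency parameter `√(min |k| 1)`, comparable to `|κ|` for `|k| ≤ 1`. -/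
noncomputable def rho (k : ℝ) : ℝ := √(min |k| 1)

lemma rho_sq (k : ℝ) : rho k ^ 2 = min |k| 1 := Real.sq_sqrt (by positivity)

lemma rho_pos (hk : k ≠ 0) : 0 < rho k :=
  Real.sqrt_pos.2 (lt_min (abs_pos.2 hk) one_pos)

lemma rho_le_one (k : ℝ) : rho k ≤ 1 := Real.sqrt_le_one.2 (min_le_right _ _)

lemma rho_eq_one (h : 1 ≤ |k|) : rho k = 1 := by rw [rho, min_eq_right h, Real.sqrt_one]

lemma rho_sq_eq (h : |k| ≤ 1) : rho k ^ 2 = |k| := by rw [rho_sq, min_eq_left h]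

lemma norm_kappa_le_rho (h : |k| ≤ 1) : ‖kappa k‖ ≤ 2 * rho k := by
  have h0 : 0 ≤ rho k := Real.sqrt_nonneg _
  refine abs_le_of_sq_le_sq' ?_ (by positivity) |>.2
  nlinarith [norm_kappa_sq_le k, rho_sq_eq h, abs_nonneg k]

lemma rho_le_kappa_re (hk : k ≠ 0) : rho k ≤ 2 * (kappa k).re := by
  have h : rho k ≤ ‖kappa k‖ := by
    refine abs_le_of_sq_le_sq' ?_ (norm_nonneg _) |>.2
    rw [rho_sq]
    exact (min_le_left _ _).trans (abs_le_norm_kappa_sq k)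
  exact h.trans (norm_kappa_le_two_mul_re hk)

/-- The multiplier `κ / ik` costs one power of `ρ`. -/
lemma norm_kappa_div_ik_le (hk : k ≠ 0) : ‖kappa k / ik k‖ * rho k ≤ 2 := by
  have hx := abs_pos.2 hk
  rw [norm_div, norm_ik, div_mul_eq_mul_div, div_le_iff₀ hx]
  rcases le_total |k| 1 with h | h
  · nlinarith [norm_kappa_le_rho h, rho_sq_eq h, rho_pos hk]
  · rw [rho_eq_one h]
    linarith [norm_kappa_le k]

lemma abs_div_norm_kappa_le (hk : k ≠ 0) : |k| / ‖kappa k‖ ≤ 2 * rho k := by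
  rcases le_total |k| 1 with h | h
  · refine le_trans ?_ (norm_kappa_le_rho h)
    rw [div_le_iff₀ (norm_kappa_pos hk)]
    nlinarith [abs_le_norm_kappa_sq k]
  · rw [rho_eq_one h, div_le_iff₀ (norm_kappa_pos hk)]
    linarith [abs_le_norm_kappa hk]

lemma norm_kappa_le_rho_mul (k : ℝ) : ‖kappa k‖ ≤ 2 * (rho k * (1 + |k|)) := by
  have h0 : 0 ≤ rho k := Real.sqrt_nonneg _
  rcases le_total |k| 1 with h | h
  · nlinarith [norm_kappa_le_rho h, abs_nonneg k]
  · rw [rho_eq_one h]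
    linarith [norm_kappa_le k]

end Kappa

/-! ### Kernels for `n = 1` -/

section HeadKernels

variable {k σ : ℝ}

/-- The difference of the two decaying exponentials, multiplied by `S`. The factor `S` exactly
compensates the smallness of `κ - |k| = -ik / S`, so that the product is bounded for all `k`. -/
noncomputable def expGap (k σ : ℝ) : ℂ := sk k * (ex (-kappa k) σ - ex (-ak k) σ)

lemma norm_expGap_le (hk : k ≠ 0) (hσ : 0 ≤ σ) : ‖expGap k σ‖ ≤ |k| * σ * Real.exp (-(|k| * σ)) := by
  have h := norm_exp_sub_exp_le (a := -kappa k * σ) (b := -ak k * σ) (m := -(|k| * σ))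
    (by simp; exact mul_le_mul_of_nonneg_right (abs_le_kappa_re hk) hσ) (by simp [ak])
  have e : sk k * (-kappa k * σ - -ak k * σ) = ik k * σ := by
    linear_combination (-(σ : ℂ)) * sk_mul_sub k
  unfold expGap ex
  rw [norm_mul]
  calc _ ≤ ‖sk k‖ * (Real.exp (-(|k| * σ)) * ‖-kappa k * σ - -ak k * σ‖) := by gcongr
    _ = Real.exp (-(|k| * σ)) * ‖sk k * (-kappa k * σ - -ak k * σ)‖ := by rw [norm_mul]; ring
    _ = _ := by
      rw [e, norm_mul, norm_ik, Complex.norm_real, Real.norm_of_nonneg hσ]; ring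

lemma norm_expGap_le_one (hk : k ≠ 0) (hσ : 0 ≤ σ) : ‖expGap k σ‖ ≤ 1 :=
  (norm_expGap_le hk hσ).trans (mul_exp_neg_le_one _)

lemma norm_expGap_le_abs_mul (hk : k ≠ 0) (hσ : 0 ≤ σ) : ‖expGap k σ‖ ≤ |k| * σ :=
  (norm_expGap_le hk hσ).trans (mul_le_of_le_one_right (by positivity)
    (Real.exp_le_one_iff.2 (by rw [neg_nonpos]; positivity)))

lemma norm_ex_neg_kappa_le (hk : k ≠ 0) (hσ : 0 ≤ σ) :
    ‖ex (-kappa k) σ‖ ≤ Real.exp (-|k| * σ) := by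
  rw [norm_ex, Complex.neg_re]
  have := abs_le_kappa_re hk
  gcongr

lemma norm_ex_neg_ak (k σ : ℝ) : ‖ex (-ak k) σ‖ = Real.exp (-|k| * σ) := by
  rw [norm_ex, Complex.neg_re, ak_re]

lemma exp_neg_abs_le_one (k : ℝ) (hσ : 0 ≤ σ) : Real.exp (-|k| * σ) ≤ 1 :=
  Real.exp_le_one_iff.2 (mul_nonpos_of_nonpos_of_nonneg (by simp) hσ)

lemma norm_expGap_le_kappa (hk : k ≠ 0) (hσ : 0 ≤ σ) : ‖expGap k σ‖ ≤ 4 * ‖kappa k‖ := by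
  unfold expGap
  rw [norm_mul]
  have h := norm_sub_le (ex (-kappa k) σ) (ex (-ak k) σ)
  have h1 := (norm_ex_neg_kappa_le hk hσ).trans (exp_neg_abs_le_one k hσ)
  have h2 := (norm_ex_neg_ak k σ).trans_le (exp_neg_abs_le_one k hσ)
  calc _ ≤ (2 * ‖kappa k‖) * 2 := by
        gcongr
        · exact norm_sk_le hk
        · linarith
    _ = _ := by ring

lemma norm_expGap_le_rho (hk : k ≠ 0) (hσ : 0 ≤ σ) : ‖expGap k σ‖ ≤ 8 * rho k := by
  rcases le_total |k| 1 with h | h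
  · linarith [norm_expGap_le_kappa hk hσ, norm_kappa_le_rho h]
  · rw [rho_eq_one h]; linarith [norm_expGap_le_one hk hσ]

lemma norm_ex_sub_ex_neg_le {z : ℂ} (hz : 0 ≤ z.re) (hσ : 0 ≤ σ) :
    ‖ex z σ - ex (-z) σ‖ ≤ 2 * Real.exp (z.re * σ) := by
  refine (norm_sub_le _ _).trans ?_
  rw [norm_ex, norm_ex, Complex.neg_re, two_mul]
  gcongr
  linarith

lemma norm_ex_sub_ex_neg_le_mul {z : ℂ} (hz : 0 ≤ z.re) (hσ : 0 ≤ σ) :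
    ‖ex z σ - ex (-z) σ‖ ≤ 2 * (‖z‖ * σ) * Real.exp (z.re * σ) := by
  have := norm_exp_sub_exp_le (a := z * σ) (b := -z * σ) (m := z.re * σ) (by simp)
    (by simp; nlinarith)
  refine this.trans_eq ?_
  rw [show z * σ - -z * σ = 2 * (z * σ) by ring, norm_mul, norm_mul, Complex.norm_real,
    Real.norm_of_nonneg hσ, Complex.norm_ofNat]
  ring

lemma norm_ex_sub_ex_neg_sub_le {z : ℂ} (hz : 0 ≤ z.re) (hσ : 0 ≤ σ) :
    ‖ex z σ - ex (-z) σ - 2 * (z * σ)‖ ≤ 2 * (‖z‖ ^ 2 * σ ^ 2) * Real.exp (z.re * σ) := by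
  have := norm_exp_sub_exp_neg_sub_le (z := z * σ) (by simp; positivity)
  rw [norm_mul, Complex.norm_real, Real.norm_of_nonneg hσ] at this
  simpa [ex, mul_pow] using this

lemma norm_ex_neg_sub_one_add_le {z : ℂ} (hz : 0 ≤ z.re) (hσ : 0 ≤ σ) :
    ‖ex (-z) σ - 1 + z * σ‖ ≤ ‖z‖ ^ 2 * σ ^ 2 := by
  have := norm_exp_sub_one_sub_le (z := -z * σ) (m := 0)
    (by simp; positivity) le_rfl
  rw [norm_mul, Complex.norm_real, Real.norm_of_nonneg hσ, norm_neg, Real.exp_zero, one_mul,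
    mul_pow] at this
  simpa [ex, sub_neg_eq_add] using this

lemma kerH_one_zero_eq (hk : k ≠ 0) :
    kerH 1 0 k σ = -(ik k / ak k) * (ex (ak k) σ - ex (-ak k) σ) + 2 * expGap k σ := by
  have h1 := ak_ne_zero hk
  simp only [kerH, sk_sq_eq_ak, expGap]
  field_simp
  ring

lemma kerH_one_one_eq (hk : k ≠ 0) :
    kerH 1 1 k σ = -(ex (ak k) σ - ex (-ak k) σ) - 2 * (kappa k / ik k) * expGap k σ := by
  have h1 := ik_ne_zero hk
  simp only [kerH, sk_sq_eq_kappa, expGap]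
  field_simp
  ring

lemma kerF_one_zero_eq (hk : k ≠ 0) :
    kerF 1 0 k σ = ik k / kappa k * (ex (kappa k) σ - ex (-kappa k) σ) - 2 * expGap k σ := by
  have h1 := kappa_ne_zero hk
  simp only [kerF, sk_sq_eq_kappa, expGap]
  field_simp
  ring

lemma kerF_one_one_eq (hk : k ≠ 0) :
    kerF 1 1 k σ = (ex (kappa k) σ - ex (-kappa k) σ) + 2 * (ak k / ik k) * expGap k σ := by
  have h1 := ik_ne_zero hk
  simp only [kerF, sk_sq_eq_ak, expGap]
  field_simp
  ring

lemma norm_ik_div_ak (hk : k ≠ 0) : ‖ik k / ak k‖ = 1 := by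
  rw [norm_div, norm_ik, norm_ak, div_self (abs_ne_zero.2 hk)]

lemma norm_ak_div_ik (hk : k ≠ 0) : ‖ak k / ik k‖ = 1 := by
  rw [norm_div, norm_ik, norm_ak, div_self (abs_ne_zero.2 hk)]

lemma one_le_exp_mul {c : ℝ} (hc : 0 ≤ c) (hσ : 0 ≤ σ) : 1 ≤ Real.exp (c * σ) :=
  Real.one_le_exp (by positivity)

lemma norm_kerH_one_zero_le (hk : k ≠ 0) (hσ : 0 ≤ σ) :
    ‖kerH 1 0 k σ‖ ≤ 30 * Real.exp (|k| * σ) := by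
  have h1 := norm_ex_sub_ex_neg_le (z := ak k) (σ := σ) (by simp [ak_re]) hσ
  rw [ak_re] at h1
  have h2 := norm_expGap_le_one hk hσ
  have h3 := one_le_exp_mul (abs_nonneg k) hσ
  rw [kerH_one_zero_eq hk]
  refine (norm_add_le _ _).trans ?_
  rw [norm_mul, norm_neg, norm_ik_div_ak hk, norm_mul, Complex.norm_ofNat]
  linarith

lemma rho_bounds (hk : k ≠ 0) (h : |k| ≤ 1) : |k| ^ 2 ≤ rho k ^ 3 ∧
    |k| * ‖kappa k‖ ≤ 2 * rho k ^ 3 ∧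
    ‖sk k‖ * ‖kappa k‖ ^ 2 ≤ 8 * rho k ^ 3 ∧ ‖sk k‖ * |k| ^ 2 ≤ 4 * rho k ^ 3 := by
  have hs := norm_sk_le hk
  have ha := norm_kappa_le_rho h
  have h0 := rho_pos hk
  have h1 := rho_le_one k
  have ha2 : ‖kappa k‖ ^ 2 ≤ 2 * rho k ^ 2 := by
    nlinarith [norm_kappa_sq_le k, rho_sq_eq h, abs_nonneg k]
  rw [← rho_sq_eq h]
  refine ⟨?_, ?_, ?_, ?_⟩
  · nlinarith [pow_pos h0 3]
  · nlinarith [pow_pos h0 2]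
  · calc _ ≤ (2 * (2 * rho k)) * (2 * rho k ^ 2) := by gcongr; linarith
      _ = _ := by ring
  · calc _ ≤ (2 * (2 * rho k)) * (rho k ^ 2 * 1) := by
          rw [pow_two (rho k ^ 2)]
          gcongr
          · linarith
          · nlinarith
      _ = _ := by ring

/-- The kernel vanishes to second order at the wall. -/
lemma norm_kerH_one_zero_le_sq (hk : k ≠ 0) (hσ : 0 ≤ σ) :
    ‖kerH 1 0 k σ‖ ≤ 30 * (rho k ^ 3 * (σ + 1) ^ 2) * Real.exp (|k| * σ) := by
  have hE := one_le_exp_mul (abs_nonneg k) hσ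
  rcases le_total |k| 1 with h | h
  · have h1 := norm_ex_sub_ex_neg_sub_le (z := ak k) (σ := σ) (by simp [ak_re]) hσ
    have h2 := norm_ex_neg_sub_one_add_le (z := kappa k) (kappa_re_pos hk).le hσ
    have h3 := norm_ex_neg_sub_one_add_le (z := ak k) (by simp [ak_re]) hσ
    rw [ak_re, norm_ak] at h1
    rw [norm_ak] at h3
    have e : kerH 1 0 k σ = -(ik k / ak k) * (ex (ak k) σ - ex (-ak k) σ - 2 * (ak k * σ)) +
        2 * (sk k * (ex (-kappa k) σ - 1 + kappa k * σ)) -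
        2 * (sk k * (ex (-ak k) σ - 1 + ak k * σ)) := by
      rw [kerH_one_zero_eq hk, expGap]
      have h0 : ik k / ak k * ak k = ik k := div_mul_cancel₀ _ (ak_ne_zero hk)
      linear_combination (-2 * (σ : ℂ)) * h0 - (2 * (σ : ℂ)) * sk_mul_sub k
    obtain ⟨b1, -, b3, b4⟩ := rho_bounds hk h
    rw [e]
    refine (norm_sub_le _ _).trans ((add_le_add_left (norm_add_le _ _) _).trans ?_)
    simp only [norm_mul, norm_neg, norm_ik_div_ak hk, Complex.norm_ofNat, one_mul]
    have h0 := rho_pos hk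
    calc _ ≤ 2 * (|k| ^ 2 * σ ^ 2) * Real.exp (|k| * σ) +
          2 * (‖sk k‖ * (‖kappa k‖ ^ 2 * σ ^ 2)) + 2 * (‖sk k‖ * (|k| ^ 2 * σ ^ 2)) := by gcongr
      _ = 2 * (|k| ^ 2 * σ ^ 2) * Real.exp (|k| * σ) +
          2 * (‖sk k‖ * ‖kappa k‖ ^ 2 * σ ^ 2) + 2 * (‖sk k‖ * |k| ^ 2 * σ ^ 2) := by ring
      _ ≤ 2 * (rho k ^ 3 * (σ + 1) ^ 2) * Real.exp (|k| * σ) +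
          2 * (8 * rho k ^ 3 * (σ + 1) ^ 2) + 2 * (4 * rho k ^ 3 * (σ + 1) ^ 2) := by
        gcongr <;> linarith
      _ ≤ _ := by
        have := mul_le_mul_of_nonneg_left hE (by positivity : 0 ≤ rho k ^ 3 * (σ + 1) ^ 2)
        have : 0 ≤ rho k ^ 3 * (σ + 1) ^ 2 * Real.exp (|k| * σ) := by positivity
        nlinarith
  · rw [rho_eq_one h]
    refine (norm_kerH_one_zero_le hk hσ).trans ?_
    gcongr
    nlinarith

lemma norm_kerF_one_zero_le (hk : k ≠ 0) (hσ : 0 ≤ σ) :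
    ‖kerF 1 0 k σ‖ ≤ 30 * rho k * Real.exp ((kappa k).re * σ) := by
  have h1 := norm_ex_sub_ex_neg_le (kappa_re_pos hk).le hσ
  have h2 := norm_expGap_le_rho hk hσ
  have h3 := one_le_exp_mul (kappa_re_pos hk).le hσ
  have h0 := rho_pos hk
  rw [kerF_one_zero_eq hk]
  refine (norm_sub_le _ _).trans ?_
  rw [norm_mul, norm_mul, Complex.norm_ofNat, norm_div, norm_ik]
  calc _ ≤ 2 * rho k * (2 * Real.exp ((kappa k).re * σ)) + 2 * (8 * rho k) := by
        gcongr; exact abs_div_norm_kappa_le hk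
    _ ≤ _ := by nlinarith

/-- The kernel vanishes to second order at the wall. -/
lemma norm_kerF_one_zero_le_sq (hk : k ≠ 0) (hσ : 0 ≤ σ) :
    ‖kerF 1 0 k σ‖ ≤
      30 * rho k * (rho k ^ 2 * (σ + 1) ^ 2) * Real.exp ((kappa k).re * σ) := by
  have hE := one_le_exp_mul (kappa_re_pos hk).le hσ
  have h0 := rho_pos hk
  rcases le_total |k| 1 with h | h
  · have h1 := norm_ex_sub_ex_neg_sub_le (kappa_re_pos hk).le hσ
    have h2 := norm_ex_neg_sub_one_add_le (z := kappa k) (kappa_re_pos hk).le hσ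
    have h3 := norm_ex_neg_sub_one_add_le (z := ak k) (by simp [ak_re]) hσ
    rw [norm_ak] at h3
    have e : kerF 1 0 k σ = ik k / kappa k * (ex (kappa k) σ - ex (-kappa k) σ - 2 * (kappa k * σ)) -
        2 * (sk k * (ex (-kappa k) σ - 1 + kappa k * σ)) +
        2 * (sk k * (ex (-ak k) σ - 1 + ak k * σ)) := by
      rw [kerF_one_zero_eq hk, expGap]
      have h0 : ik k / kappa k * kappa k = ik k := div_mul_cancel₀ _ (kappa_ne_zero hk)
      linear_combination (2 * (σ : ℂ)) * h0 + (2 * (σ : ℂ)) * sk_mul_sub k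
    obtain ⟨-, b2, b3, b4⟩ := rho_bounds hk h
    rw [e]
    refine (norm_add_le _ _).trans ((add_le_add_left (norm_sub_le _ _) _).trans ?_)
    simp only [norm_mul, norm_div, norm_ik, Complex.norm_ofNat]
    have ha := norm_kappa_pos hk
    calc _ ≤ |k| / ‖kappa k‖ * (2 * (‖kappa k‖ ^ 2 * σ ^ 2) * Real.exp ((kappa k).re * σ)) +
          2 * (‖sk k‖ * (‖kappa k‖ ^ 2 * σ ^ 2)) + 2 * (‖sk k‖ * (|k| ^ 2 * σ ^ 2)) := by gcongr
      _ = 2 * (|k| * ‖kappa k‖ * σ ^ 2) * Real.exp ((kappa k).re * σ) +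
          2 * (‖sk k‖ * ‖kappa k‖ ^ 2 * σ ^ 2) + 2 * (‖sk k‖ * |k| ^ 2 * σ ^ 2) := by
        field_simp
      _ ≤ 2 * (2 * rho k ^ 3 * (σ + 1) ^ 2) * Real.exp ((kappa k).re * σ) +
          2 * (8 * rho k ^ 3 * (σ + 1) ^ 2) + 2 * (4 * rho k ^ 3 * (σ + 1) ^ 2) := by
        gcongr <;> linarith
      _ ≤ _ := by
        have := mul_le_mul_of_nonneg_left hE (by positivity : 0 ≤ rho k ^ 3 * (σ + 1) ^ 2)
        have : 0 ≤ rho k ^ 3 * (σ + 1) ^ 2 * Real.exp ((kappa k).re * σ) := by positivity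
        nlinarith
  · refine (norm_kerF_one_zero_le hk hσ).trans ?_
    rw [rho_eq_one h]
    gcongr ?_ * _
    nlinarith

lemma norm_kerH_one_one_le (hk : k ≠ 0) (hσ : 0 ≤ σ) :
    ‖kerH 1 1 k σ‖ ≤ 34 * Real.exp (|k| * σ) := by
  have h1 := norm_ex_sub_ex_neg_le (z := ak k) (σ := σ) (by simp [ak_re]) hσ
  rw [ak_re] at h1
  have h2 := norm_expGap_le_rho hk hσ
  have h3 := one_le_exp_mul (abs_nonneg k) hσ
  have h4 := norm_kappa_div_ik_le hk
  rw [kerH_one_one_eq hk]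
  refine (norm_sub_le _ _).trans ?_
  rw [norm_neg, norm_mul, norm_mul, Complex.norm_ofNat]
  have : ‖kappa k / ik k‖ * ‖expGap k σ‖ ≤ ‖kappa k / ik k‖ * (8 * rho k) := by gcongr
  linarith

/-- The kernel vanishes to first order at the wall. -/
lemma norm_kerH_one_one_le_mul (hk : k ≠ 0) (hσ : 0 ≤ σ) :
    ‖kerH 1 1 k σ‖ ≤ 34 * (rho k * (σ + 1)) * Real.exp (|k| * σ) := by
  have h0 := rho_pos hk
  have h3 := one_le_exp_mul (abs_nonneg k) hσ
  rcases le_total |k| 1 with h | h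
  · have h1 := norm_ex_sub_ex_neg_le_mul (z := ak k) (σ := σ) (by simp [ak_re]) hσ
    rw [ak_re, norm_ak] at h1
    have h2 : ‖kappa k / ik k‖ * ‖expGap k σ‖ ≤ 2 * rho k * (σ + 1) := by
      rw [norm_div, norm_ik]
      calc _ ≤ ‖kappa k‖ / |k| * (|k| * σ) := by gcongr; exact norm_expGap_le_abs_mul hk hσ
        _ = ‖kappa k‖ * σ := by field_simp [abs_ne_zero.2 hk]
        _ ≤ _ := by gcongr; exact norm_kappa_le_rho h; linarith
    have h4 : |k| * σ ≤ rho k * (σ + 1) := by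
      rw [← rho_sq_eq h]
      gcongr
      · nlinarith [rho_le_one k]
      · linarith
    rw [kerH_one_one_eq hk]
    refine (norm_sub_le _ _).trans ?_
    rw [norm_neg, norm_mul, norm_mul, Complex.norm_ofNat]
    have h5 := mul_le_mul_of_nonneg_right h4 (by positivity : 0 ≤ Real.exp (|k| * σ))
    have h6 := mul_le_mul_of_nonneg_left h3 (by positivity : 0 ≤ rho k * (σ + 1))
    nlinarith
  · rw [rho_eq_one h]
    refine (norm_kerH_one_one_le hk hσ).trans ?_
    gcongr
    linarith

lemma norm_kerF_one_one_le (hk : k ≠ 0) (hσ : 0 ≤ σ) :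
    ‖kerF 1 1 k σ‖ ≤ 10 * Real.exp ((kappa k).re * σ) := by
  have h1 := norm_ex_sub_ex_neg_le (kappa_re_pos hk).le hσ
  have h2 := norm_expGap_le_one hk hσ
  have h3 := one_le_exp_mul (kappa_re_pos hk).le hσ
  rw [kerF_one_one_eq hk]
  refine (norm_add_le _ _).trans ?_
  rw [norm_mul, norm_mul, Complex.norm_ofNat, norm_ak_div_ik hk]
  linarith

/-- The kernel vanishes to first order at the wall. -/
lemma norm_kerF_one_one_le_mul (hk : k ≠ 0) (hσ : 0 ≤ σ) :
    ‖kerF 1 1 k σ‖ ≤ 10 * (rho k * (σ + 1)) * Real.exp ((kappa k).re * σ) := by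
  have h0 := rho_pos hk
  have h3 := one_le_exp_mul (kappa_re_pos hk).le hσ
  rcases le_total |k| 1 with h | h
  · have h1 := norm_ex_sub_ex_neg_le_mul (kappa_re_pos hk).le hσ
    have h2 := norm_expGap_le_abs_mul hk hσ
    have h4 : |k| * σ ≤ rho k * (σ + 1) := by
      rw [← rho_sq_eq h]
      gcongr
      · nlinarith [rho_le_one k]
      · linarith
    have h5 : ‖kappa k‖ * σ ≤ 2 * rho k * (σ + 1) := by
      gcongr
      · exact norm_kappa_le_rho h
      · linarith
    rw [kerF_one_one_eq hk]
    refine (norm_add_le _ _).trans ?_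
    rw [norm_mul, norm_mul, Complex.norm_ofNat, norm_ak_div_ik hk]
    have h6 := mul_le_mul_of_nonneg_right h5 (by positivity : 0 ≤ Real.exp ((kappa k).re * σ))
    have h7 := mul_le_mul_of_nonneg_left h3 (by positivity : 0 ≤ rho k * (σ + 1))
    nlinarith
  · rw [rho_eq_one h]
    refine (norm_kerF_one_one_le hk hσ).trans ?_
    gcongr
    linarith

end HeadKernels

/-! ### Kernels for `n = 2, 3` -/

section TailKernels

variable {k σ : ℝ}

lemma norm_two_exp_le {a b : ℂ} {A B : ℝ} (hk : k ≠ 0) (hσ : 0 ≤ σ) (ha : ‖a‖ ≤ A) (hb : ‖b‖ ≤ B) :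
    ‖a * ex (-kappa k) σ + b * ex (-ak k) σ‖ ≤ (A + B) * Real.exp (-|k| * σ) := by
  refine (norm_add_le _ _).trans ?_
  rw [norm_mul, norm_mul, norm_ex_neg_ak, add_mul]
  have h0 : 0 ≤ A := (norm_nonneg _).trans ha
  gcongr
  exact norm_ex_neg_kappa_le hk hσ

lemma norm_sk_sq_div_ik_le (hk : k ≠ 0) : ‖sk k ^ 2 / ik k‖ ≤ 4 * (1 + |k|) := by
  have hx := abs_pos.2 hk
  rw [norm_div, norm_pow, norm_ik, div_le_iff₀ hx]
  have := norm_kappa_sq_le k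
  calc _ ≤ (2 * ‖kappa k‖) ^ 2 := by gcongr; exact norm_sk_le hk
    _ ≤ _ := by nlinarith

lemma norm_kappa_mul_sk_div_ik_le (hk : k ≠ 0) : ‖kappa k * sk k / ik k‖ ≤ 2 * (1 + |k|) := by
  have hx := abs_pos.2 hk
  rw [norm_div, norm_mul, norm_ik, div_le_iff₀ hx]
  have := norm_kappa_sq_le k
  calc _ ≤ ‖kappa k‖ * (2 * ‖kappa k‖) := by gcongr; exact norm_sk_le hk
    _ ≤ _ := by nlinarith

lemma norm_ak_mul_sk_div_ik_le (hk : k ≠ 0) : ‖ak k * sk k / ik k‖ ≤ 2 * (1 + |k|) := by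
  rw [mul_div_right_comm, norm_mul, norm_ak_div_ik hk, one_mul]
  linarith [norm_sk_le hk, norm_kappa_le k]

lemma norm_kerF_two_zero_le (hk : k ≠ 0) (hσ : 0 ≤ σ) :
    ‖kerF 2 0 k σ‖ ≤ 30 * (rho k * (1 + |k|)) * Real.exp (-|k| * σ) := by
  have h1 := norm_kappa_le_rho_mul k
  have h2 := norm_sk_le hk
  have h3 : ‖ik k / kappa k‖ ≤ ‖kappa k‖ := by
    rw [norm_div, norm_ik, div_le_iff₀ (norm_kappa_pos hk), ← pow_two]
    exact abs_le_norm_kappa_sq k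
  have h4 : ‖sk k ^ 2 / kappa k‖ ≤ 4 * ‖kappa k‖ := by
    rw [norm_div, norm_pow, div_le_iff₀ (norm_kappa_pos hk)]
    calc _ ≤ (2 * ‖kappa k‖) ^ 2 := by gcongr
      _ = _ := by ring
  refine (norm_two_exp_le hk hσ (norm_sub_le _ _) (norm_mul_le _ _)).trans ?_
  rw [Complex.norm_ofNat]
  gcongr
  linarith [norm_nonneg (kappa k)]

lemma norm_kerF_two_one_le (hk : k ≠ 0) (hσ : 0 ≤ σ) :
    ‖kerF 2 1 k σ‖ ≤ 30 * (1 + |k|) * Real.exp (-|k| * σ) := by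
  have h1 := norm_sk_sq_div_ik_le hk
  have h2 := norm_ak_mul_sk_div_ik_le hk
  have e : kerF 2 1 k σ = (-1 + sk k ^ 2 / ik k) * ex (-kappa k) σ +
      (-2 * (ak k * sk k / ik k)) * ex (-ak k) σ := by
    simp only [kerF]; ring
  rw [e]
  refine (norm_two_exp_le hk hσ (norm_add_le _ _) (norm_mul_le _ _)).trans ?_
  rw [norm_neg, norm_neg, norm_one, Complex.norm_ofNat]
  gcongr
  linarith [abs_nonneg k]

lemma norm_kerH_two_zero_le (hk : k ≠ 0) (hσ : 0 ≤ σ) :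
    ‖kerH 2 0 k σ‖ ≤ 30 * (1 + |k|) * Real.exp (-|k| * σ) := by
  have h1 := norm_sk_sq_div_ik_le hk
  have h2 := norm_sk_le hk
  have h3 := norm_kappa_le k
  have e : kerH 2 0 k σ = (2 * sk k) * ex (-kappa k) σ +
      (-(ik k / ak k + sk k ^ 2 / ak k)) * ex (-ak k) σ := by
    simp only [kerH]; ring
  have h4 : ‖sk k ^ 2 / ak k‖ = ‖sk k ^ 2 / ik k‖ := by
    rw [norm_div, norm_div, norm_ak, norm_ik]
  rw [e]
  refine (norm_two_exp_le hk hσ (norm_mul_le _ _)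
    ((norm_neg _).trans_le (norm_add_le _ _))).trans ?_
  rw [norm_ik_div_ak hk, h4, Complex.norm_ofNat]
  gcongr
  linarith [abs_nonneg k]

lemma norm_kerH_two_one_le (hk : k ≠ 0) (hσ : 0 ≤ σ) :
    ‖kerH 2 1 k σ‖ ≤ 30 * (1 + |k|) * Real.exp (-|k| * σ) := by
  have h1 := norm_sk_sq_div_ik_le hk
  have h2 := norm_kappa_mul_sk_div_ik_le hk
  have e : kerH 2 1 k σ = (-2 * (kappa k * sk k / ik k)) * ex (-kappa k) σ +
      (1 + sk k ^ 2 / ik k) * ex (-ak k) σ := by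
    simp only [kerH]; ring
  rw [e]
  refine (norm_two_exp_le hk hσ (norm_mul_le _ _) (norm_add_le _ _)).trans ?_
  rw [norm_neg, norm_one, Complex.norm_ofNat]
  gcongr
  linarith [abs_nonneg k]

lemma norm_kerG_two_zero_le (hk : k ≠ 0) (hσ : 0 ≤ σ) :
    ‖kerG 2 0 k σ‖ ≤ 30 * (1 + |k|) * Real.exp (-|k| * σ) := by
  have h1 := norm_sk_sq_div_ik_le hk
  have h2 := norm_kappa_mul_sk_div_ik_le hk
  refine (norm_two_exp_le hk hσ ((norm_neg _).trans_le (norm_add_le _ _))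
    (norm_mul_le _ _)).trans ?_
  rw [norm_one, Complex.norm_ofNat]
  gcongr
  linarith [abs_nonneg k]

/-- The singular multiplier `κ / ik` is compensated by the cancellation in
`1 + S ^ 2 / ik = 2 |k| S / ik`. -/
lemma norm_kerG_two_one_le (hk : k ≠ 0) (hσ : 0 ≤ σ) :
    ‖kerG 2 1 k σ‖ ≤ 30 * (1 + |k|) * Real.exp (-|k| * σ) := by
  have h2 := norm_kappa_mul_sk_div_ik_le hk
  have h0 := ik_ne_zero hk
  have e : kerG 2 1 k σ = (2 * (ak k / ik k * (kappa k * sk k / ik k))) * ex (-kappa k) σ +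
      (-2 * (ak k / ik k * (kappa k * sk k / ik k))) * ex (-ak k) σ := by
    simp only [kerG, sk_sq_eq_ak]
    field_simp
    ring
  rw [e]
  refine (norm_two_exp_le hk hσ (norm_mul_le _ _) (norm_mul_le _ _)).trans ?_
  rw [norm_neg, Complex.norm_ofNat, norm_mul, norm_ak_div_ik hk]
  gcongr
  linarith [abs_nonneg k]

lemma norm_kerK_two_zero_le (hk : k ≠ 0) (hσ : 0 ≤ σ) :
    ‖kerK 2 0 k σ‖ ≤ 30 * (1 + |k|) * Real.exp (-|k| * σ) := by
  have h1 := norm_sk_sq_div_ik_le hk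
  have h2 := norm_ak_mul_sk_div_ik_le hk
  have e : kerK 2 0 k σ = (-2 * (ak k * sk k / ik k)) * ex (-kappa k) σ +
      (-(1 - sk k ^ 2 / ik k)) * ex (-ak k) σ := by
    simp only [kerK]; ring
  rw [e]
  refine (norm_two_exp_le hk hσ (norm_mul_le _ _)
    ((norm_neg _).trans_le (norm_sub_le _ _))).trans ?_
  rw [norm_neg, norm_one, Complex.norm_ofNat]
  gcongr
  linarith [abs_nonneg k]

lemma norm_kerK_two_one_le (hk : k ≠ 0) (hσ : 0 ≤ σ) :
    ‖kerK 2 1 k σ‖ ≤ 30 * (1 + |k|) * Real.exp (-|k| * σ) := by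
  have h1 := norm_sk_sq_div_ik_le hk
  have h2 := norm_kappa_mul_sk_div_ik_le hk
  have e : kerK 2 1 k σ = ak k / ik k * ((2 * (kappa k * sk k / ik k)) * ex (-kappa k) σ +
      (1 - sk k ^ 2 / ik k) * ex (-ak k) σ) := by
    simp only [kerK]; ring
  rw [e, norm_mul, norm_ak_div_ik hk, one_mul]
  refine (norm_two_exp_le hk hσ (norm_mul_le _ _) (norm_sub_le _ _)).trans ?_
  rw [norm_one, Complex.norm_ofNat]
  gcongr
  linarith [abs_nonneg k]

lemma norm_front_of_ne_three {n : ℕ} (hn : n ≠ 3) (z : ℂ) (τ : ℝ) :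
    ‖front n z τ‖ = 1 / 2 * Real.exp (-z.re * τ) := by
  rw [front, if_neg hn, norm_mul, norm_ex, Complex.neg_re]
  norm_num

lemma norm_front_three_mul_le {z : ℂ} {t s : ℝ} (hz : 0 ≤ z.re) (ht : 1 ≤ t) :
    ‖front 3 z (t - 1) * ex (-z) (s - 1)‖ ≤ Real.exp (-z.re * (s - t)) := by
  rw [front, if_pos rfl, norm_mul, norm_mul, norm_ex, Complex.neg_re]
  have h := norm_ex_sub_ex_neg_le hz (sub_nonneg.2 ht)
  have e : Real.exp (-z.re * (s - t)) =
      Real.exp (z.re * (t - 1)) * Real.exp (-z.re * (s - 1)) := by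
    rw [← Real.exp_add]; congr 1; ring
  rw [e]
  have h2 : ‖(1 / 2 : ℂ)‖ = 1 / 2 := by norm_num
  rw [h2]
  gcongr
  linarith

/-- The front factor for `n = 3` vanishes at the wall. -/
lemma norm_front_three_mul_le_mul {z : ℂ} {t s : ℝ} (hz : 0 ≤ z.re) (ht : 1 ≤ t) :
    ‖front 3 z (t - 1) * ex (-z) (s - 1)‖ ≤ ‖z‖ * t * Real.exp (-z.re * (s - t)) := by
  rw [front, if_pos rfl, norm_mul, norm_mul, norm_ex, Complex.neg_re]
  have h := norm_ex_sub_ex_neg_le_mul hz (sub_nonneg.2 ht)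
  have e : Real.exp (-z.re * (s - t)) =
      Real.exp (z.re * (t - 1)) * Real.exp (-z.re * (s - 1)) := by
    rw [← Real.exp_add]; congr 1; ring
  rw [e, ← mul_assoc]
  have h2 : ‖(1 / 2 : ℂ)‖ = 1 / 2 := by norm_num
  rw [h2]
  refine mul_le_mul_of_nonneg_right ?_ (Real.exp_pos _).le
  have : ‖z‖ * (t - 1) * Real.exp (z.re * (t - 1)) ≤ ‖z‖ * t * Real.exp (z.re * (t - 1)) := by
    gcongr; linarith
  linarith

end TailKernels

/-! ### Continuity of the kernels -/

section KernelContinuity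

/-- The domain of the kernels: `k ≠ 0` and arbitrary `σ`. -/
def kernelDomain : Set (ℝ × ℝ) := {0}ᶜ ×ˢ univ

lemma continuousOn_kappa : ContinuousOn kappa {0}ᶜ := by
  intro k hk
  refine ContinuousAt.continuousWithinAt ?_
  exact ContinuousAt.cpow (by fun_prop) continuousAt_const (slitPlane_of_ne_zero hk)

lemma continuous_ak : Continuous ak := by unfold ak; fun_prop

lemma continuous_ik : Continuous ik := by unfold ik; fun_prop

lemma kernel_continuousOn {n m : ℕ} (hn : n = 1 ∨ n = 2 ∨ n = 3) (hm : m = 0 ∨ m = 1) :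
    ContinuousOn (Function.uncurry (kerF n m)) kernelDomain ∧
    ContinuousOn (Function.uncurry (kerG n m)) kernelDomain ∧
    ContinuousOn (Function.uncurry (kerH n m)) kernelDomain ∧
    ContinuousOn (Function.uncurry (kerK n m)) kernelDomain := by
  have hκ : ContinuousOn (fun z : ℝ × ℝ => kappa z.1) kernelDomain :=
    continuousOn_kappa.comp continuousOn_fst fun z hz => hz.1
  have ha : ContinuousOn (fun z : ℝ × ℝ => ak z.1) kernelDomain :=
    (continuous_ak.comp continuous_fst).continuousOn
  have hi : ContinuousOn (fun z : ℝ × ℝ => ik z.1) kernelDomain :=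
    (continuous_ik.comp continuous_fst).continuousOn
  have hκ0 : ∀ z ∈ kernelDomain, kappa z.1 ≠ 0 := fun z hz => kappa_ne_zero hz.1
  have ha0 : ∀ z ∈ kernelDomain, ak z.1 ≠ 0 := fun z hz => ak_ne_zero hz.1
  have hi0 : ∀ z ∈ kernelDomain, ik z.1 ≠ 0 := fun z hz => ik_ne_zero hz.1
  rcases hn with rfl | rfl | rfl <;> rcases hm with rfl | rfl <;>
  · refine ⟨?_, ?_, ?_, ?_⟩ <;>
    · simp only [Function.uncurry_def, kerF, kerG, kerH, kerK, sk, ex]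
      fun_prop (disch := assumption)

end KernelContinuity

/-! ### Absorbing powers into exponentials -/

section Absorb

lemma exists_rpow_le_exp {a c : ℝ} (ha : 0 ≤ a) (hc : 0 < c) :
    ∃ C, 0 ≤ C ∧ ∀ y, 0 ≤ y → y ^ a ≤ C * Real.exp (c * y) := by
  rcases ha.eq_or_lt with rfl | ha
  · refine ⟨1, zero_le_one, fun y hy => ?_⟩
    rw [Real.rpow_zero, one_mul]
    exact Real.one_le_exp (by positivity)
  · refine ⟨(a / c) ^ a, by positivity, fun y hy => ?_⟩
    have h : y ≤ a / c * Real.exp (c * y / a) := by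
      have := Real.add_one_le_exp (c * y / a)
      calc y = a / c * (c * y / a) := by field_simp
        _ ≤ _ := by gcongr; linarith
    calc y ^ a ≤ (a / c * Real.exp (c * y / a)) ^ a := by gcongr
      _ = _ := by
        rw [Real.mul_rpow (by positivity) (by positivity), ← Real.exp_mul]
        congr 2; field_simp

/-- An exponential factor with rate at least `c p`, where `p ^ r = min |k| 1`, turns each power of
`p` into a power of `1 / t` and the weight at time `1` into the weight at time `t`. -/
lemma exists_absorb {α r a c : ℝ} (hα : 0 ≤ α) (hr : 0 ≤ r) (ha : 0 ≤ a) (hc : 0 < c) :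
    ∃ C, 0 ≤ C ∧ ∀ k t p γ : ℝ, 1 ≤ t → 0 < p → p ≤ 1 → p ^ r = min |k| 1 → c * p ≤ γ →
      p ^ a * Real.exp (-γ * (t - 1)) * mu α 1 k 1 ≤ C * (1 / t ^ a * mu α r k t) := by
  obtain ⟨C₁, h₁, H₁⟩ := exists_rpow_le_exp ha (half_pos hc)
  obtain ⟨C₂, h₂, H₂⟩ := exists_rpow_le_exp (mul_nonneg hr hα) (half_pos hc)
  refine ⟨Real.exp c * (C₁ * (1 + C₂)), by positivity, fun k t p γ ht hp hp1 hpr hγ => ?_⟩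
  have ht0 : 0 < t := by linarith
  set y := p * t with hy
  have hy0 : 0 ≤ y := by positivity
  have m0 : 0 < mu α r k t := mu_pos ht0
  have hmu : mu α 1 k 1 ≤ (1 + y ^ (r * α)) * mu α r k t := by
    have e : y ^ (r * α) = (min |k| 1 * t ^ r) ^ α := by
      rw [hy, Real.rpow_mul (by positivity), Real.mul_rpow hp.le ht0.le, hpr]
    rw [e]
    unfold mu
    rw [mul_one_div, div_le_div_iff₀ (mu_denom_pos one_pos) (mu_denom_pos ht0), one_mul,
      Real.one_rpow, mul_one]
    have hk : 0 ≤ |k| ^ α := by positivity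
    rcases le_total |k| 1 with h | h
    · rw [min_eq_left h]
      have : 0 ≤ (|k| * t ^ r) ^ α := by positivity
      nlinarith
    · rw [min_eq_right h, one_mul, Real.mul_rpow (by positivity) (by positivity)]
      have : 0 ≤ (t ^ r) ^ α := by positivity
      nlinarith
  have hexp : Real.exp (-γ * (t - 1)) ≤ Real.exp c * Real.exp (-(c * y)) := by
    rw [← Real.exp_add]
    refine Real.exp_le_exp.2 ?_
    have : c * p * (t - 1) ≤ γ * (t - 1) := mul_le_mul_of_nonneg_right hγ (by linarith)
    rw [hy]
    nlinarith
  have hpa : p ^ a = 1 / t ^ a * y ^ a := by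
    rw [hy, Real.mul_rpow hp.le ht0.le]; field_simp
  have hmain : y ^ a * (1 + y ^ (r * α)) ≤ C₁ * (1 + C₂) * Real.exp (c * y) := by
    have e1 := H₁ y hy0
    have e2 := H₂ y hy0
    have e3 : 1 ≤ Real.exp (c / 2 * y) := Real.one_le_exp (by positivity)
    have e4 : Real.exp (c * y) = Real.exp (c / 2 * y) * Real.exp (c / 2 * y) := by
      rw [← Real.exp_add]; congr 1; ring
    calc _ ≤ C₁ * Real.exp (c / 2 * y) * (Real.exp (c / 2 * y) + C₂ * Real.exp (c / 2 * y)) := by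
          gcongr
      _ = _ := by rw [e4]; ring
  calc _ ≤ (1 / t ^ a * y ^ a) * (Real.exp c * Real.exp (-(c * y))) *
        ((1 + y ^ (r * α)) * mu α r k t) := by
        rw [hpa]; gcongr; exact (mu_pos one_pos).le
    _ = (y ^ a * (1 + y ^ (r * α))) * Real.exp (-(c * y)) *
        (Real.exp c * (1 / t ^ a * mu α r k t)) := by ring
    _ ≤ (C₁ * (1 + C₂) * Real.exp (c * y)) * Real.exp (-(c * y)) *
        (Real.exp c * (1 / t ^ a * mu α r k t)) := by gcongr
    _ = _ := by
      rw [mul_assoc (C₁ * (1 + C₂)), ← Real.exp_add, add_neg_cancel, Real.exp_zero]; ring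

lemma exists_absorb_abs {α a : ℝ} (hα : 0 ≤ α) (ha : 0 ≤ a) :
    ∃ C, 0 ≤ C ∧ ∀ k t : ℝ, k ≠ 0 → 1 ≤ t →
      rho k ^ (2 * a) * Real.exp (-(|k| / 2) * (t - 1)) * mu α 1 k 1 ≤
        C * (1 / t ^ a * muBar α k t) := by
  obtain ⟨C, hC, H⟩ := exists_absorb (r := 1) hα zero_le_one ha (half_pos one_pos)
  refine ⟨C, hC, fun k t hk ht => ?_⟩
  have h0 := rho_pos hk
  have := H k t (rho k ^ 2) (|k| / 2) ht (by positivity) (pow_le_one₀ h0.le (rho_le_one k))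
    (by rw [Real.rpow_one, rho_sq]) (by rw [rho_sq]; linarith [min_le_left |k| 1])
  rwa [← Real.rpow_natCast, ← Real.rpow_mul h0.le] at this

lemma exists_absorb_kappa {α a : ℝ} (hα : 0 ≤ α) (ha : 0 ≤ a) :
    ∃ C, 0 ≤ C ∧ ∀ k t : ℝ, k ≠ 0 → 1 ≤ t →
      rho k ^ a * Real.exp (-((kappa k).re / 2) * (t - 1)) * mu α 1 k 1 ≤
        C * (1 / t ^ a * muTilde α k t) := by
  obtain ⟨C, hC, H⟩ := exists_absorb (r := 2) (c := 1 / 4) hα zero_le_two ha (by norm_num)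
  refine ⟨C, hC, fun k t hk ht => ?_⟩
  have h0 := rho_pos hk
  exact H k t (rho k) ((kappa k).re / 2) ht h0 (rho_le_one k) (by rw [Real.rpow_two, rho_sq])
    (by linarith [rho_le_kappa_re hk])

end Absorb

/-! ### The components as integral operators -/

section Components

/-- The general form of the components `ω`, `η`, `ψ`, `φ`: exponent `z`, kernel `K`, source `Q`. -/
noncomputable def comp (n : ℕ) (z : ℝ → ℂ) (K Q : ℝ → ℝ → ℂ) (k t : ℝ) : ℂ :=
  front n (z k) (t - 1) * ∫ s in range n t, K k (s - 1) * Q k s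

variable {α q : ℝ} {Q : ℝ → ℝ → ℂ} {n : ℕ}

lemma comp_eq (n : ℕ) (z : ℝ → ℂ) (K Q : ℝ → ℝ → ℂ) (k t : ℝ) :
    comp n z K Q k t = ∫ s in range n t, front n (z k) (t - 1) * K k (s - 1) * Q k s := by
  rw [comp, ← integral_const_mul]
  simp_rw [mul_assoc]

lemma measurableSet_range (n : ℕ) (t : ℝ) : MeasurableSet (range n t) := by
  unfold range; split_ifs
  exacts [measurableSet_Icc, measurableSet_Ici]

lemma one_le_of_mem_range {t s : ℝ} (ht : 1 ≤ t) (hs : s ∈ range n t) : 1 ≤ s := by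
  unfold range at hs; split_ifs at hs
  exacts [hs.1, ht.trans hs]

lemma weight_le_inv_pow {p k s : ℝ} (hα : 0 ≤ α) (hp : 3 ≤ p) (hq : 3 ≤ q) (hs : 1 ≤ s) :
    weight α p q k s ≤ 2 * (s ^ (-3 : ℝ) * mu α 1 k 1) := by
  refine (weight_mono hs hp hq).trans ((weight_le_rpow hα hs).trans_eq ?_)
  rw [Real.rpow_neg (by linarith)]; ring

/-- From time `t` on, the weight of the source decreases at least like `s⁻³`. -/
lemma weight_le_div_pow {p k t s : ℝ} (hα : 0 ≤ α) (hp : 3 ≤ p) (hq : 3 ≤ q) (ht : 1 ≤ t)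
    (hts : t ≤ s) : weight α p q k s ≤ t ^ (3:ℝ) * s ^ (-3 : ℝ) * weight α p q k t := by
  have ht0 : 0 < t := by linarith
  have hs0 : 0 < s := by linarith
  have key : ∀ p : ℝ, 3 ≤ p → 1 / s ^ p ≤ t ^ (3:ℝ) * s ^ (-3 : ℝ) * (1 / t ^ p) := by
    intro p hp
    have h := Real.rpow_le_rpow ht0.le hts (sub_nonneg.2 hp)
    rw [Real.rpow_sub ht0, Real.rpow_sub hs0, div_le_div_iff₀ (by positivity) (by positivity)] at h
    rw [Real.rpow_neg hs0.le, ← div_eq_mul_inv, div_mul_div_comm, mul_one,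
      div_le_div_iff₀ (by positivity) (by positivity)]
    linarith
  have m1 : muBar α k s ≤ muBar α k t := mu_antitone_time hα zero_le_one ht0 hts
  have m2 : muTilde α k s ≤ muTilde α k t := mu_antitone_time hα zero_le_two ht0 hts
  have n1 : 0 < muBar α k s := muBar_pos hs0
  have n2 : 0 < muTilde α k s := muTilde_pos hs0
  unfold weight
  calc _ ≤ t ^ (3:ℝ) * s ^ (-3 : ℝ) * (1 / t ^ p) * muBar α k t +
        t ^ (3:ℝ) * s ^ (-3 : ℝ) * (1 / t ^ q) * muTilde α k t := by
        gcongr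
        · exact key p hp
        · exact key q hq
    _ = _ := by ring

/-- Between times `t / 2` and `t` the weight is comparable to its value at `t`. -/
lemma weight_le_of_half_le {p k t s : ℝ} (hα : 0 ≤ α) (hp : 0 ≤ p) (hq : 0 ≤ q) (ht : 0 < t)
    (hs : t / 2 ≤ s) :
    weight α p q k s ≤ (2 ^ p * 2 ^ α + 2 ^ q * 4 ^ α) * weight α p q k t := by
  have hs0 : 0 < s := by linarith
  have key : ∀ p : ℝ, 0 ≤ p → 1 / s ^ p ≤ 2 ^ p * (1 / t ^ p) := by
    intro p hp
    rw [mul_one_div, div_le_div_iff₀ (by positivity) (by positivity), one_mul,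
      ← Real.mul_rpow (by norm_num) hs0.le]
    exact Real.rpow_le_rpow ht.le (by linarith) hp
  have m1 : muBar α k s ≤ 2 ^ α * muBar α k t := by
    refine mu_le_of_le hα one_le_two ht hs0 ?_
    rw [Real.rpow_one, Real.rpow_one]
    nlinarith [abs_nonneg k]
  have m2 : muTilde α k s ≤ 4 ^ α * muTilde α k t := by
    refine mu_le_of_le hα (by norm_num) ht hs0 ?_
    rw [Real.rpow_two, Real.rpow_two]
    have : t ^ 2 ≤ 4 * s ^ 2 := by nlinarith
    nlinarith [abs_nonneg k]
  have n1 : 0 < muBar α k s := muBar_pos hs0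
  have n2 : 0 < muTilde α k s := muTilde_pos hs0
  have n3 : 0 < muBar α k t := muBar_pos ht
  have n4 : 0 < muTilde α k t := muTilde_pos ht
  unfold weight
  calc _ ≤ 2 ^ p * (1 / t ^ p) * (2 ^ α * muBar α k t) +
        2 ^ q * (1 / t ^ q) * (4 ^ α * muTilde α k t) := by
        gcongr
        · exact key p hp
        · exact key q hq
    _ = (2 ^ p * 2 ^ α) * (1 / t ^ p * muBar α k t) +
        (2 ^ q * 4 ^ α) * (1 / t ^ q * muTilde α k t) := by ring
    _ ≤ _ := by
      rw [mul_add]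
      gcongr
      · exact le_add_of_nonneg_right (by positivity)
      · exact le_add_of_nonneg_left (by positivity)

lemma integral_Ici_exp {γ t : ℝ} (hγ : 0 < γ) :
    IntegrableOn (fun s => Real.exp (-γ * (s - t))) (Ici t) ∧
      ∫ s in Ici t, Real.exp (-γ * (s - t)) = 1 / γ := by
  have e : ∀ s, Real.exp (-γ * (s - t)) = Real.exp (γ * t) * Real.exp (-γ * s) := by
    intro s; rw [← Real.exp_add]; congr 1; ring
  simp_rw [e]
  constructor
  · rw [integrableOn_Ici_iff_integrableOn_Ioi]
    exact (integrableOn_exp_mul_Ioi (by linarith) t).const_mul _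
  · rw [integral_const_mul, integral_Ici_eq_integral_Ioi, integral_exp_mul_Ioi (by linarith),
      neg_div_neg_eq, mul_div_assoc', ← Real.exp_add]
    simp

lemma integral_Ici_rpow_neg_three {t : ℝ} (ht : 0 < t) :
    IntegrableOn (fun s : ℝ => s ^ (-3 : ℝ)) (Ici t) ∧
      ∫ s in Ici t, s ^ (-3 : ℝ) = t ^ (-2 : ℝ) / 2 := by
  constructor
  · rw [integrableOn_Ici_iff_integrableOn_Ioi]
    exact integrableOn_Ioi_rpow_of_lt (by norm_num) ht
  · rw [integral_Ici_eq_integral_Ioi, integral_Ioi_rpow_of_lt (by norm_num) ht]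
    norm_num [neg_div]
    ring

/-- Pointwise estimate of the components integrated over `[t, ∞)`: integration contributes the
smaller of `t`, from the decay of the source, and `1 / γ`, from the decay of the kernel. -/
lemma exists_tail_bound (hα : 0 ≤ α) (hq : 3 ≤ q) (hQ : Q ∈ BSpace α (7 / 2) q) (hn : n ≠ 1) :
    ∃ C, 0 ≤ C ∧ ∀ (z : ℝ → ℂ) (K : ℝ → ℝ → ℂ) (k t B γ : ℝ), k ≠ 0 → 1 ≤ t → 0 < γ → 0 ≤ B →
      (∀ s, t ≤ s → ‖front n (z k) (t - 1) * K k (s - 1)‖ ≤ B * Real.exp (-γ * (s - t))) →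
      ‖comp n z K Q k t‖ ≤ C * (B * min t (1 / γ) * weight α (7 / 2) q k t) := by
  obtain ⟨-, C, hC, hQ⟩ := mem_BSpace_iff.1 hQ
  refine ⟨C, hC, fun z K k t B γ hk ht hγ hB hK => ?_⟩
  have ht0 : 0 < t := by linarith
  have w0 := weight_pos (α := α) (p := 7 / 2) (q := q) (k := k) ht0
  have hr : range n t = Ici t := if_neg hn
  rw [comp_eq, hr]
  have pt : ∀ s, t ≤ s → ‖front n (z k) (t - 1) * K k (s - 1) * Q k s‖ ≤
      B * Real.exp (-γ * (s - t)) * (C * weight α (7 / 2) q k s) := by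
    intro s hs
    rw [norm_mul]
    exact mul_le_mul (hK s hs) (hQ k s hk (ht.trans hs)) (norm_nonneg _) (by positivity)
  rcases le_total t (1 / γ) with h | h
  · rw [min_eq_left h]
    obtain ⟨i1, i2⟩ := integral_Ici_rpow_neg_three ht0
    refine (norm_integral_le_of_norm_le
      (i1.const_mul (B * C * t ^ (3:ℝ) * weight α (7 / 2) q k t)) ?_).trans ?_
    · refine (ae_restrict_iff' measurableSet_Ici).2 (ae_of_all _ fun s hs => (pt s hs).trans ?_)
      have hs : t ≤ s := hs
      have hs0 : 0 < s := by linarith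
      have ws := weight_pos (α := α) (p := 7 / 2) (q := q) (k := k) hs0
      have e1 : Real.exp (-γ * (s - t)) ≤ 1 :=
        Real.exp_le_one_iff.2 (by nlinarith)
      calc _ ≤ B * 1 * (C * (t ^ (3:ℝ) * s ^ (-3 : ℝ) * weight α (7 / 2) q k t)) := by
            gcongr
            exact weight_le_div_pow hα (by norm_num) hq ht hs
        _ = _ := by ring
    · rw [integral_const_mul, i2]
      have e : t ^ (3:ℝ) * t ^ (-2:ℝ) = t := by
        rw [← Real.rpow_add ht0]; norm_num
      calc _ = C * (B * (t ^ (3:ℝ) * t ^ (-2:ℝ)) * weight α (7 / 2) q k t) / 2 := by ring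
        _ = C * (B * t * weight α (7 / 2) q k t) / 2 := by rw [e]
        _ ≤ _ := half_le_self (by positivity)
  · rw [min_eq_right h]
    obtain ⟨i1, i2⟩ := integral_Ici_exp (t := t) hγ
    refine (norm_integral_le_of_norm_le
      (i1.const_mul (B * C * weight α (7 / 2) q k t)) ?_).trans ?_
    · refine (ae_restrict_iff' measurableSet_Ici).2 (ae_of_all _ fun s hs => (pt s hs).trans ?_)
      have hs : t ≤ s := hs
      have hw : weight α (7 / 2) q k s ≤ weight α (7 / 2) q k t := by
        unfold weight
        have hs0 : 0 < s := by linarith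
        have n1 : 0 < muBar α k s := muBar_pos hs0
        have n2 : 0 < muTilde α k s := muTilde_pos hs0
        gcongr ?_ * ?_ + ?_ * ?_
        · exact one_div_le_one_div_of_le (by positivity)
            (Real.rpow_le_rpow ht0.le hs (by norm_num))
        · exact mu_antitone_time hα zero_le_one ht0 hs
        · exact one_div_le_one_div_of_le (by positivity)
            (Real.rpow_le_rpow ht0.le hs (by linarith))
        · exact mu_antitone_time hα zero_le_two ht0 hs
      calc _ ≤ B * Real.exp (-γ * (s - t)) * (C * weight α (7 / 2) q k t) := by gcongr
        _ = _ := by ring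
    · rw [integral_const_mul, i2]
      exact le_of_eq (by ring)

lemma integral_Icc_exp_le {γ t : ℝ} (hγ : 0 < γ) (ht : 1 ≤ t) :
    IntegrableOn (fun s => Real.exp (-γ * (t - s))) (Icc 1 t) ∧
      ∫ s in Icc 1 t, Real.exp (-γ * (t - s)) ≤ min t (1 / γ) := by
  have hint : IntegrableOn (fun s => Real.exp (-γ * (t - s))) (Icc 1 t) :=
    Continuous.integrableOn_Icc (by fun_prop)
  refine ⟨hint, le_min ?_ ?_⟩
  · calc _ ≤ ∫ s in Icc 1 t, (1:ℝ) := by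
          refine setIntegral_mono_on hint (by simp) measurableSet_Icc fun s hs => ?_
          exact Real.exp_le_one_iff.2 (by nlinarith [hs.2])
      _ ≤ _ := by
        simp only [integral_const, MeasurableSet.univ, measureReal_restrict_apply, univ_inter,
          Real.volume_real_Icc, smul_eq_mul, mul_one]
        exact max_le (by linarith) (by linarith)
  · have e : ∀ s, Real.exp (-γ * (t - s)) = Real.exp (-γ * t) * Real.exp (γ * s) := by
      intro s; rw [← Real.exp_add]; congr 1; ring
    have hI := (integrableOn_exp_mul_Iic hγ t).const_mul (Real.exp (-γ * t))
    simp_rw [e]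
    calc _ ≤ ∫ s in Iic t, Real.exp (-γ * t) * Real.exp (γ * s) :=
          setIntegral_mono_set hI (ae_of_all _ fun s => by positivity)
            (Icc_subset_Iic_self.eventuallyLE)
      _ = _ := by
        rw [integral_const_mul, integral_exp_mul_Iic hγ, mul_div_assoc', ← Real.exp_add]
        simp

lemma integral_Icc_rpow_le {b t : ℝ} (hb : b < -1) :
    IntegrableOn (fun s : ℝ => s ^ b) (Icc 1 t) ∧
      ∫ s in Icc 1 t, s ^ b ≤ ∫ s in Ici (1:ℝ), s ^ b := by
  have h : IntegrableOn (fun s : ℝ => s ^ b) (Ici 1) := by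
    rw [integrableOn_Ici_iff_integrableOn_Ioi]
    exact integrableOn_Ioi_rpow_of_lt hb one_pos
  refine ⟨h.mono_set Icc_subset_Ici_self, setIntegral_mono_set h ?_
    Icc_subset_Ici_self.eventuallyLE⟩
  refine (ae_restrict_iff' measurableSet_Ici).2 (ae_of_all _ fun s hs => ?_)
  exact Real.rpow_nonneg (zero_le_one.trans hs) b

/-- Pointwise estimate of the components integrated over `[1, t]`. Before the midpoint
`(1 + t) / 2` the exponential supplies a gain and the source is integrated over all times, with the
bound `A₁ s ^ b` for the kernel; after the midpoint the source has the size it has at time `t`, and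
the bound `A₂ s ^ c` is used. -/
lemma exists_head_bound {b c : ℝ} (hα : 0 ≤ α) (hq : 3 ≤ q) (hQ : Q ∈ BSpace α (7 / 2) q)
    (hb : b < 2) (hc : 0 ≤ c) :
    ∃ C, 0 ≤ C ∧ ∀ (z : ℝ → ℂ) (K : ℝ → ℝ → ℂ) (k t A₁ A₂ : ℝ), k ≠ 0 → 1 ≤ t → 0 < (z k).re →
      0 ≤ A₁ → 0 ≤ A₂ →
      (∀ s, 1 ≤ s → ‖K k (s - 1)‖ ≤ A₁ * s ^ b * Real.exp ((z k).re * (s - 1))) →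
      (∀ s, 1 ≤ s → ‖K k (s - 1)‖ ≤ A₂ * s ^ c * Real.exp ((z k).re * (s - 1))) →
      ‖comp 1 z K Q k t‖ ≤ C * (A₁ * Real.exp (-((z k).re / 2) * (t - 1)) * mu α 1 k 1 +
        A₂ * min t (1 / (z k).re) * (t ^ c * weight α (7 / 2) q k t)) := by
  obtain ⟨-, C, hC, hQ⟩ := mem_BSpace_iff.1 hQ
  set I := ∫ s in Ici (1:ℝ), s ^ (b - 3) with hI
  have hI0 : 0 ≤ I := setIntegral_nonneg measurableSet_Ici fun s hs =>
    Real.rpow_nonneg (zero_le_one.trans hs) _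
  set D : ℝ := 2 ^ (7 / 2 : ℝ) * 2 ^ α + 2 ^ q * 4 ^ α with hD
  have hD0 : 0 ≤ D := by positivity
  refine ⟨C * (2 * I + D), by positivity, fun z K k t A₁ A₂ hk ht hγ h1 h2 H1 H2 => ?_⟩
  set γ := (z k).re with hγdef
  have ht0 : 0 < t := by linarith
  have w0 := weight_pos (α := α) (p := 7 / 2) (q := q) (k := k) ht0
  have m0 : 0 < mu α 1 k 1 := mu_pos one_pos
  have hr : range 1 t = Icc 1 t := if_pos rfl
  rw [comp_eq, hr]
  obtain ⟨i1, i2⟩ := integral_Icc_exp_le hγ ht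
  obtain ⟨j1, j2⟩ := integral_Icc_rpow_le (t := t) (show b - 3 < -1 by linarith)
  set X := C * (A₁ * Real.exp (-(γ / 2) * (t - 1)) * (2 * mu α 1 k 1)) with hX
  set Y := C * (D * (A₂ * (t ^ c * weight α (7 / 2) q k t))) with hY
  have hX0 : 0 ≤ X := by positivity
  have hY0 : 0 ≤ Y := by positivity
  refine (norm_integral_le_of_norm_le ((j1.const_mul X).add (i1.const_mul Y)) ?_).trans ?_
  · refine (ae_restrict_iff' measurableSet_Icc).2 (ae_of_all _ fun s hs => ?_)
    obtain ⟨hs1, hst⟩ := hs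
    have hs0 : 0 < s := by linarith
    have q1 := hQ k s hk hs1
    have ws := weight_pos (α := α) (p := 7 / 2) (q := q) (k := k) hs0
    simp only [Pi.add_apply]
    rw [norm_mul, norm_mul, norm_front_of_ne_three (by norm_num)]
    have hfe : 1 / 2 * Real.exp (-γ * (t - 1)) * Real.exp (γ * (s - 1)) ≤
        Real.exp (-γ * (t - s)) := by
      rw [mul_assoc, ← Real.exp_add, show -γ * (t - 1) + γ * (s - 1) = -γ * (t - s) by ring]
      linarith [Real.exp_pos (-γ * (t - s))]
    have f1 : 0 ≤ Y * Real.exp (-γ * (t - s)) := by positivity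
    have f2 : 0 ≤ X * s ^ (b - 3) := by positivity
    rcases le_total s ((1 + t) / 2) with h | h
    · refine le_trans ?_ (le_add_of_nonneg_right f1)
      have e1 : Real.exp (-γ * (t - s)) ≤ Real.exp (-(γ / 2) * (t - 1)) :=
        Real.exp_le_exp.2 (by nlinarith)
      calc _ ≤ 1 / 2 * Real.exp (-γ * (t - 1)) * (A₁ * s ^ b * Real.exp (γ * (s - 1))) *
            (C * (2 * (s ^ (-3 : ℝ) * mu α 1 k 1))) := by
            gcongr
            · exact H1 s hs1
            · exact q1.trans (mul_le_mul_of_nonneg_left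
                (weight_le_inv_pow hα (by norm_num) hq hs1) hC)
        _ = (1 / 2 * Real.exp (-γ * (t - 1)) * Real.exp (γ * (s - 1))) *
            (C * (A₁ * (2 * mu α 1 k 1)) * (s ^ b * s ^ (-3 : ℝ))) := by ring
        _ ≤ Real.exp (-(γ / 2) * (t - 1)) *
            (C * (A₁ * (2 * mu α 1 k 1)) * (s ^ b * s ^ (-3 : ℝ))) := by
            gcongr; exact hfe.trans e1
        _ = _ := by
            rw [← Real.rpow_add hs0, ← sub_eq_add_neg, hX]; ring
    · refine le_trans ?_ (le_add_of_nonneg_left f2)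
      calc _ ≤ 1 / 2 * Real.exp (-γ * (t - 1)) * (A₂ * t ^ c * Real.exp (γ * (s - 1))) *
            (C * (D * weight α (7 / 2) q k t)) := by
            gcongr
            · refine (H2 s hs1).trans ?_
              gcongr
            · refine q1.trans (mul_le_mul_of_nonneg_left ?_ hC)
              exact weight_le_of_half_le hα (by norm_num) (by linarith) ht0 (by linarith)
        _ = (1 / 2 * Real.exp (-γ * (t - 1)) * Real.exp (γ * (s - 1))) * Y := by rw [hY]; ring
        _ ≤ _ := by rw [mul_comm Y]; gcongr
  · have e := integral_add (j1.const_mul X) (i1.const_mul Y)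
    simp only [Pi.add_apply] at e ⊢
    rw [e, integral_const_mul, integral_const_mul]
    have hm : 0 ≤ min t (1 / γ) := le_min ht0.le (by positivity)
    calc _ ≤ X * I + Y * min t (1 / γ) := by gcongr
      _ = C * (2 * I) * (A₁ * Real.exp (-(γ / 2) * (t - 1)) * mu α 1 k 1) +
          C * D * (A₂ * min t (1 / γ) * (t ^ c * weight α (7 / 2) q k t)) := by
          rw [hX, hY]; ring
      _ ≤ C * (2 * I + D) * (A₁ * Real.exp (-(γ / 2) * (t - 1)) * mu α 1 k 1) +
          C * (2 * I + D) * (A₂ * min t (1 / γ) * (t ^ c * weight α (7 / 2) q k t)) := by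
          gcongr <;> linarith
      _ = _ := by ring

/-- Dominated convergence for the components: a kernel, including the front factor, that grows at
most linearly in `s` suffices, because the source decays like `s⁻³`. -/
lemma comp_continuousOn {z : ℝ → ℂ} {K : ℝ → ℝ → ℂ} {M : ℝ} (hα : 0 ≤ α) (hq : 3 ≤ q)
    (hQ : Q ∈ BSpace α (7 / 2) q) (hz : ContinuousOn z {0}ᶜ)
    (hK : ContinuousOn (Function.uncurry K) kernelDomain) (hM : 0 ≤ M)
    (hKM : ∀ k t s, k ≠ 0 → 1 ≤ t → s ∈ range n t →
      ‖front n (z k) (t - 1) * K k (s - 1)‖ ≤ M * (1 + |k|) * s) :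
    ContinuousOn (Function.uncurry (comp n z K Q)) domain := by
  obtain ⟨hQc, C, hC, hQ⟩ := mem_BSpace_iff.1 hQ
  have hfront : ∀ y : ℝ × ℝ → ℂ, ContinuousOn y domain →
      ContinuousOn (fun w => front n (y w) (w.2 - 1)) domain := by
    intro y hy
    unfold front ex
    split_ifs <;> fun_prop
  have hG : ∀ s, 1 ≤ s → ContinuousOn
      (fun w : ℝ × ℝ => front n (z w.1) (w.2 - 1) * K w.1 (s - 1) * Q w.1 s) domain := by
    intro s hs
    refine ((hfront (fun w => z w.1) (hz.comp continuousOn_fst fun w hw => hw.1)).mul ?_).mul ?_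
    · exact hK.comp (f := fun w : ℝ × ℝ => (w.1, s - 1)) (by fun_prop) fun w hw => ⟨hw.1, trivial⟩
    · exact hQc.comp (f := fun w : ℝ × ℝ => (w.1, s)) (by fun_prop) fun w hw => ⟨hw.1, hs⟩
  have e : EqOn (Function.uncurry (comp n z K Q)) (fun w : ℝ × ℝ => ∫ s in Ici (1:ℝ),
      (range n w.2).indicator
        (fun s => front n (z w.1) (w.2 - 1) * K w.1 (s - 1) * Q w.1 s) s) domain := by
    rintro ⟨k, t⟩ ⟨-, ht⟩
    simp only [Function.uncurry_apply_pair]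
    have hsub : range n t ⊆ Ici 1 := fun s hs => one_le_of_mem_range ht hs
    rw [comp_eq, setIntegral_indicator (measurableSet_range n t),
      inter_eq_self_of_subset_right hsub]
  refine ContinuousOn.congr ?_ e
  rintro ⟨k₀, t₀⟩ ⟨hk₀, ht₀⟩
  have hk₀ : k₀ ≠ 0 := hk₀
  have ht₀ : 1 ≤ t₀ := ht₀
  refine continuousWithinAt_of_dominated
    (bound := fun s => M * (2 + |k₀|) * (C * 2) * s ^ (-2 : ℝ)) ?_ ?_ ?_ ?_
  · filter_upwards [self_mem_nhdsWithin (s := domain)] with w hw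
    refine AEStronglyMeasurable.indicator ?_ (measurableSet_range n w.2)
    refine ContinuousOn.aestronglyMeasurable ?_ measurableSet_Ici
    refine (continuousOn_const.mul ?_).mul ?_
    · exact hK.comp (f := fun s : ℝ => (w.1, s - 1)) (by fun_prop) fun s _ => ⟨hw.1, trivial⟩
    · exact hQc.comp (f := fun s : ℝ => (w.1, s)) (by fun_prop) fun s hs => ⟨hw.1, hs⟩
  · have hnear : ∀ᶠ w : ℝ × ℝ in 𝓝[domain] (k₀, t₀), |w.1| < |k₀| + 1 := by
      have h : ContinuousAt (fun w : ℝ × ℝ => |w.1|) (k₀, t₀) := by fun_prop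
      exact (h.eventually (gt_mem_nhds (lt_add_one |k₀|))).filter_mono nhdsWithin_le_nhds
    filter_upwards [self_mem_nhdsWithin (s := domain), hnear] with ⟨k, t⟩ hw hkn
    refine (ae_restrict_iff' measurableSet_Ici).2 (ae_of_all _ fun s hs => ?_)
    have hs : 1 ≤ s := hs
    have hs0 : 0 < s := by linarith
    have ht : 1 ≤ t := hw.2
    by_cases hsr : s ∈ range n t
    · rw [indicator_of_mem hsr, norm_mul]
      have q1 : ‖Q k s‖ ≤ C * 2 * s ^ (-3 : ℝ) := by
        refine (hQ k s hw.1 hs).trans ?_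
        rw [mul_assoc]
        refine mul_le_mul_of_nonneg_left ((weight_le_inv_pow hα (by norm_num) hq hs).trans ?_) hC
        exact mul_le_mul_of_nonneg_left
          (mul_le_of_le_one_right (by positivity) (mu_le_one one_pos)) zero_le_two
      have e2 : s * s ^ (-3 : ℝ) = s ^ (-2 : ℝ) := by
        rw [← Real.rpow_one_add' hs0.le (by norm_num)]; norm_num
      calc _ ≤ (M * (2 + |k₀|) * s) * (C * 2 * s ^ (-3 : ℝ)) := by
            refine mul_le_mul ((hKM k t s hw.1 ht hsr).trans ?_) q1 (norm_nonneg _)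
              (by positivity)
            have : |k| < |k₀| + 1 := hkn
            gcongr ?_ * ?_ * s
            linarith
        _ = M * (2 + |k₀|) * (C * 2) * (s * s ^ (-3 : ℝ)) := by ring
        _ = _ := by rw [e2]
    · rw [indicator_of_notMem hsr, norm_zero]
      positivity
  · refine Integrable.const_mul ?_ _
    change IntegrableOn _ _ _
    rw [integrableOn_Ici_iff_integrableOn_Ioi]
    exact integrableOn_Ioi_rpow_of_lt (by norm_num) one_pos
  · have hne : ∀ᵐ s ∂(volume.restrict (Ici (1:ℝ))), s ≠ t₀ :=
      ae_restrict_of_ae (Measure.ae_ne volume t₀)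
    filter_upwards [hne, ae_restrict_mem measurableSet_Ici] with s hst hs
    have hs : 1 ≤ s := hs
    have hmem : ∀ᶠ w : ℝ × ℝ in 𝓝[domain] (k₀, t₀), (s ∈ range n w.2 ↔ s ∈ range n t₀) := by
      refine Eventually.filter_mono nhdsWithin_le_nhds ?_
      have hc : ContinuousAt (fun w : ℝ × ℝ => w.2) (k₀, t₀) := continuousAt_snd
      rcases lt_or_gt_of_ne hst with h | h
      · filter_upwards [hc.eventually (lt_mem_nhds h)] with w hw
        unfold range
        split_ifs
        · exact ⟨fun _ => ⟨hs, h.le⟩, fun _ => ⟨hs, hw.le⟩⟩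
        · exact ⟨fun h' => absurd hw (not_lt.2 h'), fun h' => absurd h (not_lt.2 h')⟩
      · filter_upwards [hc.eventually (gt_mem_nhds h)] with w hw
        unfold range
        split_ifs
        · exact ⟨fun h' => absurd hw (not_lt.2 h'.2), fun h' => absurd h (not_lt.2 h'.2)⟩
        · exact ⟨fun _ => h.le, fun _ => hw.le⟩
    by_cases hsr : s ∈ range n t₀
    · refine (hG s hs (k₀, t₀) ⟨hk₀, ht₀⟩).congr_of_eventuallyEq ?_ (indicator_of_mem hsr _)
      filter_upwards [hmem] with w hw
      exact indicator_of_mem (hw.2 hsr) _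
    · refine (continuousWithinAt_const (b := (0 : ℂ))).congr_of_eventuallyEq ?_
        (indicator_of_notMem hsr _)
      filter_upwards [hmem] with w hw
      exact indicator_of_notMem (fun h => hsr (hw.1 h)) _

end Components

/-! ### Membership criteria for the components -/

section Criteria

variable {α q : ℝ} {Q : ℝ → ℝ → ℂ} {z : ℝ → ℂ} {K : ℝ → ℝ → ℂ}

/-- Membership of a component with `n = 1`. The part of the integral after the midpoint is `t ^ (d + c)`
times the weight of the source; the part before it is controlled by the last hypothesis. -/
lemma head_mem {b c d p q' M : ℝ} {A₁ A₂ : ℝ → ℝ} (hα : 0 ≤ α) (hq : 3 ≤ q)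
    (hQ : Q ∈ BSpace α (7 / 2) q) (hz : ContinuousOn z {0}ᶜ) (hz0 : ∀ k, k ≠ 0 → 0 < (z k).re)
    (hK : ContinuousOn (Function.uncurry K) kernelDomain) (hb : b < 2) (hc : 0 ≤ c) (hc1 : c ≤ 1)
    (hM : 0 ≤ M) (hA₁ : ∀ k, k ≠ 0 → 0 ≤ A₁ k) (hA₂ : ∀ k, k ≠ 0 → 0 ≤ A₂ k)
    (hA₂M : ∀ k, k ≠ 0 → A₂ k ≤ M)
    (H₁ : ∀ k σ, k ≠ 0 → 0 ≤ σ → ‖K k σ‖ ≤ A₁ k * (σ + 1) ^ b * Real.exp ((z k).re * σ))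
    (H₂ : ∀ k σ, k ≠ 0 → 0 ≤ σ → ‖K k σ‖ ≤ A₂ k * (σ + 1) ^ c * Real.exp ((z k).re * σ))
    (hmin : ∀ k t, k ≠ 0 → 1 ≤ t → A₂ k * min t (1 / (z k).re) ≤ M * t ^ d)
    (hp : p ≤ 7 / 2 - (d + c)) (hq' : q' ≤ q - (d + c))
    (habs : ∃ C, 0 ≤ C ∧ ∀ k t, k ≠ 0 → 1 ≤ t →
      A₁ k * Real.exp (-((z k).re / 2) * (t - 1)) * mu α 1 k 1 ≤ C * weight α p q' k t) :
    comp 1 z K Q ∈ BSpace α p q' := by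
  refine mem_BSpace_iff.2 ⟨comp_continuousOn (M := M) hα hq hQ hz hK hM ?_, ?_⟩
  · intro k t s hk ht hs
    have hs1 := one_le_of_mem_range ht hs
    have hst : s ≤ t := by
      rw [range, if_pos rfl] at hs
      exact hs.2
    have h2 := H₂ k (s - 1) hk (by linarith)
    rw [sub_add_cancel] at h2
    have hsc : s ^ c ≤ s := by
      simpa using Real.rpow_le_rpow_of_exponent_le hs1 hc1
    rw [norm_mul, norm_front_of_ne_three (by norm_num)]
    have hexp : 1 / 2 * Real.exp (-(z k).re * (t - 1)) * Real.exp ((z k).re * (s - 1)) ≤ 1 := by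
      rw [mul_assoc, ← Real.exp_add]
      have : Real.exp (-(z k).re * (t - 1) + (z k).re * (s - 1)) ≤ 1 :=
        Real.exp_le_one_iff.2 (by nlinarith [hz0 k hk])
      linarith
    calc _ ≤ 1 / 2 * Real.exp (-(z k).re * (t - 1)) *
          (M * s * Real.exp ((z k).re * (s - 1))) := by
          have := hA₂M k hk
          have := hA₂ k hk
          gcongr
          refine h2.trans ?_
          gcongr
      _ = (1 / 2 * Real.exp (-(z k).re * (t - 1)) * Real.exp ((z k).re * (s - 1))) * (M * s) := by
          ring
      _ ≤ 1 * (M * s) := by gcongr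
      _ ≤ _ := by nlinarith [mul_nonneg (mul_nonneg hM (abs_nonneg k)) (by linarith : 0 ≤ s)]
  · obtain ⟨C, hC, H⟩ := exists_head_bound hα hq hQ hb hc
    obtain ⟨C', hC', H'⟩ := habs
    refine ⟨C * (C' + M), by positivity, fun k t hk ht => ?_⟩
    have ht0 : 0 < t := by linarith
    have w0 := weight_pos (α := α) (p := 7 / 2) (q := q) (k := k) ht0
    refine (H z K k t (A₁ k) (A₂ k) hk ht (hz0 k hk) (hA₁ k hk) (hA₂ k hk) ?_ ?_).trans ?_
    · intro s hs
      simpa using H₁ k (s - 1) hk (by linarith)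
    · intro s hs
      simpa using H₂ k (s - 1) hk (by linarith)
    · rw [mul_assoc C, add_mul]
      refine mul_le_mul_of_nonneg_left (add_le_add (H' k t hk ht) ?_) hC
      calc _ ≤ M * t ^ d * (t ^ c * weight α (7 / 2) q k t) :=
            mul_le_mul_of_nonneg_right (hmin k t hk ht) (by positivity)
        _ = M * (t ^ (d + c) * weight α (7 / 2) q k t) := by rw [Real.rpow_add ht0]; ring
        _ ≤ _ := by
          rw [rpow_mul_weight ht0]
          exact mul_le_mul_of_nonneg_left (weight_mono ht hp hq') hM

/-- Membership of a component with `n = 2, 3`, which is `t ^ j` times the weight of the source. -/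
lemma tail_mem {n : ℕ} {j p q' M : ℝ} {B : ℝ → ℝ → ℝ} {γ : ℝ → ℝ} (hn : n ≠ 1) (hα : 0 ≤ α)
    (hq : 3 ≤ q) (hQ : Q ∈ BSpace α (7 / 2) q) (hz : ContinuousOn z {0}ᶜ)
    (hK : ContinuousOn (Function.uncurry K) kernelDomain) (hM : 0 ≤ M)
    (hγ : ∀ k, k ≠ 0 → 0 < γ k) (hB : ∀ k t, k ≠ 0 → 1 ≤ t → 0 ≤ B k t)
    (H : ∀ k t s, k ≠ 0 → 1 ≤ t → t ≤ s →
      ‖front n (z k) (t - 1) * K k (s - 1)‖ ≤ B k t * Real.exp (-γ k * (s - t)))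
    (hBM : ∀ k t, k ≠ 0 → 1 ≤ t → B k t ≤ M * (1 + |k|) * t)
    (hmin : ∀ k t, k ≠ 0 → 1 ≤ t → B k t * min t (1 / γ k) ≤ M * t ^ j)
    (hp : p ≤ 7 / 2 - j) (hq' : q' ≤ q - j) :
    comp n z K Q ∈ BSpace α p q' := by
  refine mem_BSpace_iff.2 ⟨comp_continuousOn (M := M) hα hq hQ hz hK hM ?_, ?_⟩
  · intro k t s hk ht hs
    have hst : t ≤ s := by
      rwa [range, if_neg hn] at hs
    refine (H k t s hk ht hst).trans ?_
    have e1 : Real.exp (-γ k * (s - t)) ≤ 1 :=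
      Real.exp_le_one_iff.2 (by nlinarith [hγ k hk])
    calc _ ≤ B k t * 1 := by
          gcongr; exact hB k t hk ht
      _ ≤ M * (1 + |k|) * t := by rw [mul_one]; exact hBM k t hk ht
      _ ≤ _ := by gcongr
  · obtain ⟨C, hC, H'⟩ := exists_tail_bound hα hq hQ hn
    refine ⟨C * M, by positivity, fun k t hk ht => ?_⟩
    have ht0 : 0 < t := by linarith
    have w0 := weight_pos (α := α) (p := 7 / 2) (q := q) (k := k) ht0
    refine (H' z K k t (B k t) (γ k) hk ht (hγ k hk) (hB k t hk ht)
      fun s hs => H k t s hk ht hs).trans ?_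
    rw [mul_assoc C M]
    refine mul_le_mul_of_nonneg_left ?_ hC
    calc _ ≤ M * t ^ j * weight α (7 / 2) q k t :=
          mul_le_mul_of_nonneg_right (hmin k t hk ht) w0.le
      _ = M * (t ^ j * weight α (7 / 2) q k t) := by ring
      _ ≤ _ := by
        rw [rpow_mul_weight ht0]
        exact mul_le_mul_of_nonneg_left (weight_mono ht hp hq') hM

lemma one_add_abs_mul_min_le {k t : ℝ} (hk : k ≠ 0) (ht : 1 ≤ t) :
    (1 + |k|) * min t (1 / |k|) ≤ 2 * t := by
  have hx := abs_pos.2 hk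
  have h1 : |k| * min t (1 / |k|) ≤ 1 := by
    calc _ ≤ |k| * (1 / |k|) := by gcongr; exact min_le_right _ _
      _ = 1 := by field_simp
  have h2 := min_le_left t (1 / |k|)
  rw [add_mul]
  linarith

lemma norm_front_two_mul_le {k t s B : ℝ} (ht : 1 ≤ t) (hB : 0 ≤ B)
    (H : ‖K k (s - 1)‖ ≤ B * Real.exp (-|k| * (s - 1))) :
    ‖front 2 (z k) (t - 1) * K k (s - 1)‖ ≤
      B * Real.exp (-(z k).re * (t - 1)) * Real.exp (-|k| * (s - t)) := by
  rw [norm_mul, norm_front_of_ne_three (by norm_num)]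
  have h1 : Real.exp (-|k| * (s - 1)) ≤ Real.exp (-|k| * (s - t)) :=
    Real.exp_le_exp.2 (by nlinarith [abs_nonneg k])
  calc _ ≤ 1 / 2 * Real.exp (-(z k).re * (t - 1)) * (B * Real.exp (-|k| * (s - t))) := by
        gcongr
        exact H.trans (by gcongr)
    _ ≤ 1 * Real.exp (-(z k).re * (t - 1)) * (B * Real.exp (-|k| * (s - t))) := by
        gcongr; norm_num
    _ = _ := by ring

lemma tail_two_mem {q' : ℝ} (hα : 0 ≤ α) (hq : 3 ≤ q) (hQ : Q ∈ BSpace α (7 / 2) q)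
    (hz : ContinuousOn z {0}ᶜ) (hz0 : ∀ k, k ≠ 0 → 0 < (z k).re)
    (hK : ContinuousOn (Function.uncurry K) kernelDomain)
    (H : ∀ k σ, k ≠ 0 → 0 ≤ σ → ‖K k σ‖ ≤ 30 * (1 + |k|) * Real.exp (-|k| * σ))
    (hq' : q' ≤ q - 1) : comp 2 z K Q ∈ BSpace α (5 / 2) q' := by
  refine tail_mem (B := fun k _ => 30 * (1 + |k|)) (γ := fun k => |k|) (j := 1) (M := 60)
    (by norm_num) hα hq hQ hz hK (by norm_num) (fun k hk => abs_pos.2 hk)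
    (fun k t _ _ => by positivity) ?_ ?_ ?_ (by norm_num) hq'
  · intro k t s hk ht hts
    refine (norm_front_two_mul_le ht (by positivity)
      (H k (s - 1) hk (by linarith))).trans ?_
    refine mul_le_mul_of_nonneg_right ?_ (Real.exp_pos _).le
    refine mul_le_of_le_one_right (by positivity) (Real.exp_le_one_iff.2 ?_)
    nlinarith [hz0 k hk]
  · intro k t _ ht
    nlinarith [abs_nonneg k, mul_nonneg (abs_nonneg k) (sub_nonneg.2 ht)]
  · intro k t hk ht
    rw [Real.rpow_one, mul_assoc]
    linarith [one_add_abs_mul_min_le hk ht]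

/-- For the front factor with `κ`, whose decay acts on the scale `|k| ~ 1 / t ^ 2`, the weight `μ̄`
is not needed. -/
lemma tail_two_mem_inf {a p : ℝ} (hα : 0 ≤ α) (ha : 0 ≤ a) (hQ : Q ∈ BSpace α (7 / 2) 3)
    (hK : ContinuousOn (Function.uncurry K) kernelDomain)
    (H : ∀ k σ, k ≠ 0 → 0 ≤ σ → ‖K k σ‖ ≤ 30 * (rho k ^ a * (1 + |k|)) * Real.exp (-|k| * σ))
    (hp : p = 2 + a) : comp 2 kappa K Q ∈ BSpaceInf α p := by
  have hfront : ∀ k t s, k ≠ 0 → 1 ≤ t → t ≤ s → ‖front 2 (kappa k) (t - 1) * K k (s - 1)‖ ≤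
      30 * (rho k ^ a * (1 + |k|)) * Real.exp (-(kappa k).re * (t - 1)) *
        Real.exp (-|k| * (s - t)) := by
    intro k t s hk ht hts
    have h0 := rho_pos hk
    exact norm_front_two_mul_le ht (by positivity)
      (H k (s - 1) hk (by linarith))
  refine mem_BSpaceInf_iff.2 ⟨comp_continuousOn (M := 30) hα le_rfl hQ continuousOn_kappa hK
    (by norm_num) ?_, ?_⟩
  · intro k t s hk ht hs
    have hts : t ≤ s := by
      rwa [range, if_neg (by norm_num)] at hs
    have h0 := rho_pos hk
    have e1 : Real.exp (-(kappa k).re * (t - 1)) ≤ 1 :=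
      Real.exp_le_one_iff.2 (by nlinarith [kappa_re_pos hk])
    have e2 : Real.exp (-|k| * (s - t)) ≤ 1 :=
      Real.exp_le_one_iff.2 (by nlinarith [abs_nonneg k])
    have e3 : rho k ^ a ≤ 1 := Real.rpow_le_one h0.le (rho_le_one k) ha
    calc _ ≤ _ := hfront k t s hk ht hts
      _ ≤ 30 * (1 * (1 + |k|)) * 1 * 1 := by gcongr
      _ = 30 * (1 + |k|) * 1 := by ring
      _ ≤ _ := by gcongr; linarith
  · obtain ⟨C, hC, H'⟩ := exists_tail_bound hα le_rfl hQ (n := 2) (by norm_num)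
    obtain ⟨D, hD, hA⟩ := exists_absorb_kappa hα ha
    refine ⟨C * (120 * D), by positivity, fun k t hk ht => ?_⟩
    have ht0 : 0 < t := by linarith
    have h0 := rho_pos hk
    have w0 := weight_pos (α := α) (p := 7 / 2) (q := 3) (k := k) ht0
    have m0 : 0 < mu α 1 k 1 := mu_pos one_pos
    refine (H' kappa K k t (30 * (rho k ^ a * (1 + |k|)) * Real.exp (-(kappa k).re * (t - 1))) |k|
      hk ht (abs_pos.2 hk) (by positivity) fun s hs => hfront k t s hk ht hs).trans ?_
    rw [mul_assoc C]
    refine mul_le_mul_of_nonneg_left ?_ hC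
    have e1 : Real.exp (-(kappa k).re * (t - 1)) ≤ Real.exp (-((kappa k).re / 2) * (t - 1)) :=
      Real.exp_le_exp.2 (by nlinarith [kappa_re_pos hk])
    have e2 : t * t ^ (-3 : ℝ) = 1 / t ^ (2:ℝ) := by
      rw [← Real.rpow_one_add' ht0.le (by norm_num), one_div, ← Real.rpow_neg ht0.le]; norm_num
    calc _ = 30 * (rho k ^ a * Real.exp (-(kappa k).re * (t - 1))) *
          ((1 + |k|) * min t (1 / |k|)) * weight α (7 / 2) 3 k t := by ring
      _ ≤ 30 * (rho k ^ a * Real.exp (-((kappa k).re / 2) * (t - 1))) *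
          (2 * t) * (2 * (t ^ (-3 : ℝ) * mu α 1 k 1)) := by
          have h1 := one_add_abs_mul_min_le hk ht
          have h2 := weight_le_inv_pow (k := k) (p := 7 / 2) hα (by norm_num) le_rfl ht
          have h3 : 0 ≤ (1 + |k|) * min t (1 / |k|) := by positivity
          refine mul_le_mul (mul_le_mul ?_ h1 h3 (by positivity)) h2 w0.le (by positivity)
          gcongr
      _ = 120 * (t * t ^ (-3 : ℝ)) *
          (rho k ^ a * Real.exp (-((kappa k).re / 2) * (t - 1)) * mu α 1 k 1) := by ring
      _ ≤ 120 * (t * t ^ (-3 : ℝ)) * (D * (1 / t ^ a * muTilde α k t)) := by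
          exact mul_le_mul_of_nonneg_left (hA k t hk ht) (by positivity)
      _ = _ := by rw [e2, hp, Real.rpow_add ht0]; field_simp

lemma tail_three_mem {q' : ℝ} (hα : 0 ≤ α) (hq : 3 ≤ q) (hQ : Q ∈ BSpace α (7 / 2) q)
    (hz : ContinuousOn z {0}ᶜ) (hz0 : ∀ k, k ≠ 0 → 0 < (z k).re)
    (hK : ContinuousOn (Function.uncurry K) kernelDomain)
    (H : ∀ k σ, k ≠ 0 → ‖K k σ‖ ≤ ‖ex (-z k) σ‖)
    (hq' : q' ≤ q - 1) : comp 3 z K Q ∈ BSpace α (5 / 2) q' := by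
  refine tail_mem (B := fun k _ => 1) (γ := fun k => (z k).re) (j := 1) (M := 1)
    (by norm_num) hα hq hQ hz hK zero_le_one hz0
    (fun k t _ _ => zero_le_one) ?_ ?_ ?_ (by norm_num) hq'
  · intro k t s hk ht hts
    rw [one_mul]
    refine le_trans ?_ (norm_front_three_mul_le (hz0 k hk).le ht)
    rw [norm_mul, norm_mul]
    gcongr
    exact H k _ hk
  · intro k t _ ht
    nlinarith [abs_nonneg k, mul_nonneg (abs_nonneg k) (sub_nonneg.2 ht)]
  · intro k t hk ht
    rw [Real.rpow_one]
    linarith [min_le_left t (1 / (z k).re)]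

end Criteria

/-! ### The individual components -/

section Individual

variable {α δ θ : ℝ} {Q : ℝ → ℝ → ℂ} {K : ℝ → ℝ → ℂ}

lemma ak_re_pos (k : ℝ) (hk : k ≠ 0) : 0 < (ak k).re := by rw [ak_re]; exact abs_pos.2 hk

/-- Interpolation between a bound and the same bound improved by a factor `y`. -/
lemma le_mul_rpow_mul {A B E y θ : ℝ} (hB : 0 ≤ B) (hE : 0 ≤ E) (hy : 0 < y) (h0 : 0 ≤ θ)
    (h1 : θ ≤ 1) (hA : A ≤ B * E) (hAy : A ≤ B * y * E) : A ≤ B * y ^ θ * E := by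
  rcases le_total y 1 with h | h
  · refine hAy.trans ?_
    gcongr
    simpa using Real.rpow_le_rpow_of_exponent_ge hy h h1
  · refine hA.trans ?_
    gcongr
    exact le_mul_of_one_le_right hB (Real.one_le_rpow h h0)

lemma muBar_le_weight {p q a C k t : ℝ} (ht : 1 ≤ t) (hC : 0 ≤ C) (h : p ≤ a) :
    C * (1 / t ^ a * muBar α k t) ≤ C * weight α p q k t := by
  have h1 := muBar_pos (α := α) (k := k) (t := t) (by linarith)
  have h2 := muTilde_pos (α := α) (k := k) (t := t) (by linarith)
  refine mul_le_mul_of_nonneg_left (le_add_of_le_of_nonneg ?_ (by positivity)) hC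
  exact mul_le_mul_of_nonneg_right (one_div_rpow_le ht h) h1.le

lemma muTilde_le_weight {p q a C k t : ℝ} (ht : 1 ≤ t) (hC : 0 ≤ C) (h : q ≤ a) :
    C * (1 / t ^ a * muTilde α k t) ≤ C * weight α p q k t := by
  have h1 := muBar_pos (α := α) (k := k) (t := t) (by linarith)
  have h2 := muTilde_pos (α := α) (k := k) (t := t) (by linarith)
  refine mul_le_mul_of_nonneg_left (le_add_of_nonneg_of_le (by positivity) ?_) hC
  exact mul_le_mul_of_nonneg_right (one_div_rpow_le ht h) h2.le

lemma rho_mul_min_le {k t : ℝ} (hk : k ≠ 0) : rho k * min t (1 / (kappa k).re) ≤ 2 := by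
  have h0 := rho_pos hk
  have h1 := kappa_re_pos hk
  calc _ ≤ rho k * (1 / (kappa k).re) := by
        gcongr
        exact min_le_right _ _
    _ ≤ (2 * (kappa k).re) * (1 / (kappa k).re) := by
        gcongr
        exact rho_le_kappa_re hk
    _ = 2 := by field_simp

lemma absorb_abs_weight {a p q D : ℝ} (hα : 0 ≤ α) (ha : 0 ≤ a) (hD : 0 ≤ D) (hp : p ≤ a) :
    ∃ C, 0 ≤ C ∧ ∀ k t, k ≠ 0 → 1 ≤ t →
      D * rho k ^ (2 * a) * Real.exp (-((ak k).re / 2) * (t - 1)) * mu α 1 k 1 ≤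
        C * weight α p q k t := by
  obtain ⟨C, hC, H⟩ := exists_absorb_abs hα ha
  refine ⟨D * C, by positivity, fun k t hk ht => ?_⟩
  have := mul_le_mul_of_nonneg_left (H k t hk ht) hD
  rw [ak_re]
  refine le_trans (le_of_eq (by ring)) (this.trans ?_)
  rw [← mul_assoc]
  exact muBar_le_weight ht (by positivity) hp

lemma absorb_kappa_weight {a p q D : ℝ} (hα : 0 ≤ α) (ha : 0 ≤ a) (hD : 0 ≤ D) (hq : q ≤ a) :
    ∃ C, 0 ≤ C ∧ ∀ k t, k ≠ 0 → 1 ≤ t →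
      D * rho k ^ a * Real.exp (-((kappa k).re / 2) * (t - 1)) * mu α 1 k 1 ≤
        C * weight α p q k t := by
  obtain ⟨C, hC, H⟩ := exists_absorb_kappa hα ha
  refine ⟨D * C, by positivity, fun k t hk ht => ?_⟩
  have := mul_le_mul_of_nonneg_left (H k t hk ht) hD
  refine le_trans (le_of_eq (by ring)) (this.trans ?_)
  rw [← mul_assoc]
  exact muTilde_le_weight ht (by positivity) hq

lemma norm_kerK_one_zero (k σ : ℝ) (hk : k ≠ 0) : ‖kerK 1 0 k σ‖ = ‖kerH 1 0 k σ‖ := by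
  simp only [kerK, norm_mul, norm_neg, norm_ak_div_ik hk, one_mul]

lemma norm_kerK_one_one (k σ : ℝ) (hk : k ≠ 0) : ‖kerK 1 1 k σ‖ = ‖kerH 1 1 k σ‖ := by
  simp only [kerK, norm_mul, norm_neg, norm_ak_div_ik hk, one_mul]

/-- The logarithm that the borderline integral of `|k| ^ (3 / 2) s ^ 2 s ^ (-3)` would produce is
avoided by replacing the kernel bound with its power `θ < 1`. -/
lemma head_ak_zero_mem (hα : 0 ≤ α) (hQ : Q ∈ BSpace α (7 / 2) 3) (hδ : 0 < δ)
    (hθ0 : 0 ≤ θ) (hθ1 : θ < 1) (hθδ : 1 - δ / 2 ≤ θ)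
    (hK : ContinuousOn (Function.uncurry K) kernelDomain)
    (H : ∀ k σ, k ≠ 0 → ‖K k σ‖ = ‖kerH 1 0 k σ‖) :
    comp 1 ak K Q ∈ BSpace α (3 / 2 - δ) 2 := by
  refine head_mem (b := 2 * θ) (c := 0) (d := 1) (M := 30)
    (A₁ := fun k => 30 * rho k ^ (2 * (3 / 2 * θ))) (A₂ := fun _ => 30) hα le_rfl hQ
    continuous_ak.continuousOn ak_re_pos hK (by linarith) le_rfl zero_le_one (by norm_num)
    (fun k hk => ?_) (fun _ _ => by norm_num) (fun _ _ => le_rfl) ?_ ?_ ?_ (by linarith)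
    (by norm_num) (absorb_abs_weight hα (by positivity) (by norm_num) (by linarith))
  · have := rho_pos hk
    positivity
  · intro k σ hk hσ
    have h0 := rho_pos hk
    rw [H k σ hk, ak_re]
    have h := le_mul_rpow_mul (y := rho k ^ 3 * (σ + 1) ^ 2) (by norm_num) (Real.exp_pos _).le
      (by positivity) hθ0 hθ1.le (norm_kerH_one_zero_le hk hσ) (norm_kerH_one_zero_le_sq hk hσ)
    refine h.trans_eq ?_
    rw [Real.mul_rpow (by positivity) (by positivity), ← Real.rpow_natCast, ← Real.rpow_natCast,
      ← Real.rpow_mul h0.le, ← Real.rpow_mul (by positivity), ← mul_assoc]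
    congr 4
    push_cast; ring
  · intro k σ hk hσ
    rw [H k σ hk, Real.rpow_zero, mul_one, ak_re]
    exact norm_kerH_one_zero_le hk hσ
  · intro k t _ _
    rw [Real.rpow_one]
    linarith [min_le_left t (1 / (ak k).re)]

lemma head_ak_one_mem (hα : 0 ≤ α) (hQ : Q ∈ BSpace α (7 / 2) 4)
    (hK : ContinuousOn (Function.uncurry K) kernelDomain)
    (H : ∀ k σ, k ≠ 0 → ‖K k σ‖ = ‖kerH 1 1 k σ‖) :
    comp 1 ak K Q ∈ BSpace α (1 / 2) 3 := by
  refine head_mem (b := 1) (c := 0) (d := 1) (M := 34)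
    (A₁ := fun k => 34 * rho k ^ (2 * (1 / 2 : ℝ))) (A₂ := fun _ => 34) hα (by norm_num) hQ
    continuous_ak.continuousOn ak_re_pos hK (by norm_num) le_rfl zero_le_one (by norm_num)
    (fun k hk => ?_) (fun _ _ => by norm_num) (fun _ _ => le_rfl) ?_ ?_ ?_ (by norm_num)
    (by norm_num) (absorb_abs_weight hα (by positivity) (by norm_num) le_rfl)
  · have := rho_pos hk
    positivity
  · intro k σ hk hσ
    rw [H k σ hk, ak_re, Real.rpow_one, show (2 * (1 / 2 : ℝ)) = 1 by norm_num, Real.rpow_one,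
      mul_assoc (34 : ℝ)]
    exact norm_kerH_one_one_le_mul hk hσ
  · intro k σ hk hσ
    rw [H k σ hk, Real.rpow_zero, mul_one, ak_re]
    exact norm_kerH_one_one_le hk hσ
  · intro k t _ _
    rw [Real.rpow_one]
    linarith [min_le_left t (1 / (ak k).re)]

lemma omega_one_zero_mem (hα : 0 ≤ α) (hQ : Q ∈ BSpace α (7 / 2) 3) (hδ : 0 < δ)
    (hθ0 : 0 ≤ θ) (hθ1 : θ < 1) (hθδ : 1 - δ / 2 ≤ θ) :
    comp 1 kappa (kerF 1 0) Q ∈ BSpace α (7 / 2) (3 - δ) := by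
  refine head_mem (b := 2 * θ) (c := 0) (d := 0) (M := 60)
    (A₁ := fun k => 30 * rho k ^ (1 + 2 * θ)) (A₂ := fun k => 30 * rho k) hα le_rfl hQ
    continuousOn_kappa (fun _ => kappa_re_pos) (kernel_continuousOn (by simp) (by simp)).1 (by linarith)
    le_rfl zero_le_one (by norm_num) (fun k hk => ?_) (fun k hk => ?_) (fun k hk => ?_) ?_ ?_ ?_
    (by norm_num) (by linarith)
    (absorb_kappa_weight hα (by positivity) (by norm_num) (by linarith))
  · have := rho_pos hk
    positivity
  · have := rho_pos hk
    positivity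
  · linarith [rho_le_one k]
  · intro k σ hk hσ
    have h0 := rho_pos hk
    have h := le_mul_rpow_mul (y := rho k ^ 2 * (σ + 1) ^ 2) (by positivity) (Real.exp_pos _).le
      (by positivity) hθ0 hθ1.le (norm_kerF_one_zero_le hk hσ) (norm_kerF_one_zero_le_sq hk hσ)
    refine h.trans_eq ?_
    rw [Real.mul_rpow (by positivity) (by positivity), ← Real.rpow_natCast, ← Real.rpow_natCast,
      ← Real.rpow_mul h0.le, ← Real.rpow_mul (by positivity), Real.rpow_add h0, Real.rpow_one]
    push_cast; ring
  · intro k σ hk hσ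
    rw [Real.rpow_zero, mul_one]
    exact norm_kerF_one_zero_le hk hσ
  · intro k t hk _
    rw [Real.rpow_zero]
    linarith [rho_mul_min_le (t := t) hk]

lemma omega_one_one_mem (hα : 0 ≤ α) (hQ : Q ∈ BSpace α (7 / 2) 4) :
    comp 1 kappa (kerF 1 1) Q ∈ BSpace α (5 / 2) 1 := by
  refine head_mem (b := 1) (c := 0) (d := 1) (M := 10)
    (A₁ := fun k => 10 * rho k ^ (1 : ℝ)) (A₂ := fun k => 10) hα (by norm_num) hQ
    continuousOn_kappa (fun _ => kappa_re_pos) (kernel_continuousOn (by simp) (by simp)).1 (by norm_num)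
    le_rfl zero_le_one (by norm_num) (fun k hk => ?_) (fun k hk => by norm_num)
    (fun k hk => le_rfl) ?_ ?_ ?_ (by norm_num) (by norm_num)
    (absorb_kappa_weight hα (by positivity) (by norm_num) le_rfl)
  · have := rho_pos hk
    positivity
  · intro k σ hk hσ
    rw [Real.rpow_one, Real.rpow_one, mul_assoc (10 : ℝ)]
    exact norm_kerF_one_one_le_mul hk hσ
  · intro k σ hk hσ
    rw [Real.rpow_zero, mul_one]
    exact norm_kerF_one_one_le hk hσ
  · intro k t hk _
    rw [Real.rpow_one]
    linarith [min_le_left t (1 / (kappa k).re)]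

lemma norm_kerG_one_zero_le {k σ : ℝ} (hk : k ≠ 0) (hσ : 0 ≤ σ) :
    ‖kerG 1 0 k σ‖ ≤ 60 * Real.exp ((kappa k).re * σ) := by
  simp only [kerG, norm_mul (kappa k / ik k)]
  calc _ ≤ ‖kappa k / ik k‖ * (30 * rho k * Real.exp ((kappa k).re * σ)) := by
        gcongr; exact norm_kerF_one_zero_le hk hσ
    _ = 30 * (‖kappa k / ik k‖ * rho k) * Real.exp ((kappa k).re * σ) := by ring
    _ ≤ _ := by
      gcongr
      linarith [norm_kappa_div_ik_le hk]

lemma norm_kerG_one_zero_le_sq {k σ : ℝ} (hk : k ≠ 0) (hσ : 0 ≤ σ) :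
    ‖kerG 1 0 k σ‖ ≤ 60 * (rho k ^ 2 * (σ + 1) ^ 2) * Real.exp ((kappa k).re * σ) := by
  simp only [kerG, norm_mul (kappa k / ik k)]
  calc _ ≤ ‖kappa k / ik k‖ * (30 * rho k * (rho k ^ 2 * (σ + 1) ^ 2) *
        Real.exp ((kappa k).re * σ)) := by
        gcongr; exact norm_kerF_one_zero_le_sq hk hσ
    _ = 30 * (‖kappa k / ik k‖ * rho k) * (rho k ^ 2 * (σ + 1) ^ 2) *
        Real.exp ((kappa k).re * σ) := by ring
    _ ≤ _ := by
      gcongr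
      linarith [norm_kappa_div_ik_le hk]

lemma norm_kerG_one_one_le {k σ : ℝ} (hk : k ≠ 0) (hσ : 0 ≤ σ) :
    ‖kerG 1 1 k σ‖ ≤ 20 * (σ + 1) * Real.exp ((kappa k).re * σ) := by
  simp only [kerG, norm_mul (kappa k / ik k)]
  calc _ ≤ ‖kappa k / ik k‖ * (10 * (rho k * (σ + 1)) * Real.exp ((kappa k).re * σ)) := by
        gcongr; exact norm_kerF_one_one_le_mul hk hσ
    _ = 10 * (‖kappa k / ik k‖ * rho k) * (σ + 1) * Real.exp ((kappa k).re * σ) := by ring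
    _ ≤ _ := by
      gcongr
      linarith [norm_kappa_div_ik_le hk]

lemma eta_one_zero_mem (hα : 0 ≤ α) (hQ : Q ∈ BSpace α (7 / 2) 3) (hδ : 0 < δ)
    (hθ0 : 0 ≤ θ) (hθ1 : θ < 1) (hθδ : 1 - δ / 2 ≤ θ) :
    comp 1 kappa (kerG 1 0) Q ∈ BSpace α (5 / 2) (2 - δ) := by
  refine head_mem (b := 2 * θ) (c := 0) (d := 1) (M := 60)
    (A₁ := fun k => 60 * rho k ^ (2 * θ)) (A₂ := fun k => 60) hα le_rfl hQ
    continuousOn_kappa (fun _ => kappa_re_pos) (kernel_continuousOn (by simp) (by simp)).2.1 (by linarith)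
    le_rfl zero_le_one (by norm_num) (fun k hk => ?_) (fun k hk => by norm_num)
    (fun k hk => le_rfl) ?_ ?_ ?_ (by norm_num) (by linarith)
    (absorb_kappa_weight hα (by positivity) (by norm_num) (by linarith))
  · have := rho_pos hk
    positivity
  · intro k σ hk hσ
    have h0 := rho_pos hk
    have h := le_mul_rpow_mul (y := rho k ^ 2 * (σ + 1) ^ 2) (by positivity) (Real.exp_pos _).le
      (by positivity) hθ0 hθ1.le (norm_kerG_one_zero_le hk hσ) (norm_kerG_one_zero_le_sq hk hσ)
    refine h.trans_eq ?_
    rw [Real.mul_rpow (by positivity) (by positivity), ← Real.rpow_natCast, ← Real.rpow_natCast,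
      ← Real.rpow_mul h0.le, ← Real.rpow_mul (by positivity)]
    push_cast; ring
  · intro k σ hk hσ
    rw [Real.rpow_zero, mul_one]
    exact norm_kerG_one_zero_le hk hσ
  · intro k t hk _
    rw [Real.rpow_one]
    linarith [min_le_left t (1 / (kappa k).re)]

lemma eta_one_one_mem (hα : 0 ≤ α) (hQ : Q ∈ BSpace α (7 / 2) 4) :
    comp 1 kappa (kerG 1 1) Q ∈ BSpace α (3 / 2) 0 := by
  have hb : ∀ k σ : ℝ, k ≠ 0 → 0 ≤ σ →
      ‖kerG 1 1 k σ‖ ≤ 20 * (σ + 1) ^ (1 : ℝ) * Real.exp ((kappa k).re * σ) := by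
    intro k σ hk hσ
    rw [Real.rpow_one]
    exact norm_kerG_one_one_le hk hσ
  refine head_mem (b := 1) (c := 1) (d := 1) (M := 20)
    (A₁ := fun k => 20 * rho k ^ (0 : ℝ)) (A₂ := fun k => 20) hα (by norm_num) hQ
    continuousOn_kappa (fun _ => kappa_re_pos) (kernel_continuousOn (by simp) (by simp)).2.1 (by norm_num)
    zero_le_one le_rfl (by norm_num) (fun k hk => ?_) (fun k hk => by norm_num)
    (fun k hk => le_rfl) ?_ hb ?_ (by norm_num) (by norm_num)
    (absorb_kappa_weight hα le_rfl (by norm_num) le_rfl)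
  · have := rho_pos hk
    positivity
  · intro k σ hk hσ
    rw [Real.rpow_zero, mul_one]
    exact hb k σ hk hσ
  · intro k t hk _
    rw [Real.rpow_one]
    linarith [min_le_left t (1 / (kappa k).re)]

lemma omega_three_zero_mem (hα : 0 ≤ α) (hQ : Q ∈ BSpace α (7 / 2) 3) :
    comp 3 kappa (kerF 3 0) Q ∈ BSpace α (7 / 2) 3 := by
  refine tail_mem (B := fun k _ => 2 * rho k) (γ := fun k => (kappa k).re) (j := 0) (M := 4)
    (by norm_num) hα le_rfl hQ continuousOn_kappa (kernel_continuousOn (by simp) (by simp)).1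
    (by norm_num) (fun _ => kappa_re_pos) (fun k t hk _ => ?_) ?_ ?_ ?_ (by norm_num) (by norm_num)
  · have := rho_pos hk
    positivity
  · intro k t s hk ht hts
    have h := norm_front_three_mul_le (s := s) (kappa_re_pos hk).le ht
    have h0 := rho_pos hk
    have e : front 3 (kappa k) (t - 1) * kerF 3 0 k (s - 1) =
        ik k / kappa k * (front 3 (kappa k) (t - 1) * ex (-kappa k) (s - 1)) := by
      simp only [kerF]; ring
    rw [e, norm_mul, norm_div, norm_ik]
    gcongr
    exact abs_div_norm_kappa_le hk
  · intro k t hk ht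
    have h1 := rho_le_one k
    nlinarith [abs_nonneg k, mul_nonneg (abs_nonneg k) (sub_nonneg.2 ht)]
  · intro k t hk _
    rw [Real.rpow_zero]
    linarith [rho_mul_min_le (t := t) hk]

/-- The multiplier `κ / ik` is singular at `k = 0`; the vanishing of the front factor at the wall
compensates it at the cost of a factor `t`. -/
lemma eta_three_one_mem (hα : 0 ≤ α) (hQ : Q ∈ BSpace α (7 / 2) 4) :
    comp 3 kappa (kerG 3 1) Q ∈ BSpace α (3 / 2) 2 := by
  refine tail_mem (B := fun k t => 2 * t) (γ := fun k => (kappa k).re) (j := 2) (M := 2)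
    (by norm_num) hα (by norm_num) hQ continuousOn_kappa
    (kernel_continuousOn (by simp) (by simp)).2.1
    (by norm_num) (fun _ => kappa_re_pos) (fun k t hk ht => by linarith) ?_ ?_ ?_ (by norm_num)
    (by norm_num)
  · intro k t s hk ht hts
    have hx := abs_pos.2 hk
    have e : front 3 (kappa k) (t - 1) * kerG 3 1 k (s - 1) =
        kappa k / ik k * (front 3 (kappa k) (t - 1) * ex (-kappa k) (s - 1)) := by
      simp only [kerG]; ring
    rw [e, norm_mul, norm_div, norm_ik]
    rcases le_total |k| 1 with h | h
    · calc _ ≤ ‖kappa k‖ / |k| * (‖kappa k‖ * t * Real.exp (-(kappa k).re * (s - t))) := by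
            gcongr
            exact norm_front_three_mul_le_mul (kappa_re_pos hk).le ht
        _ = ‖kappa k‖ ^ 2 / |k| * t * Real.exp (-(kappa k).re * (s - t)) := by ring
        _ ≤ _ := by
            gcongr
            rw [div_le_iff₀ hx]
            nlinarith [norm_kappa_sq_le k]
    · calc _ ≤ 2 * Real.exp (-(kappa k).re * (s - t)) := by
            gcongr
            · rw [div_le_iff₀ hx]
              linarith [norm_kappa_le k]
            · exact norm_front_three_mul_le (kappa_re_pos hk).le ht
        _ ≤ _ := by gcongr; linarith
  · intro k t hk ht
    nlinarith [abs_nonneg k, mul_nonneg (abs_nonneg k) (by linarith : 0 ≤ t)]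
  · intro k t hk ht
    rw [Real.rpow_two]
    nlinarith [min_le_left t (1 / (kappa k).re)]

end Individual

end WallFlow

open WallFlow in
theorem mainTheorem3 (α δ : ℝ) (hα : 1 < α) (hδ : 0 < δ)
    (F : ℝ × ℝ → ℝ × ℝ) (hF : WallFlow.IsForce F)
    (W : (ℝ → ℝ → ℂ) × (ℝ → ℝ → ℂ) × (ℝ → ℝ → ℂ)) (hW : WallFlow.IsSolution α F W)
    (Q : ℕ → ℝ → ℝ → ℂ) (hQ : Q = WallFlow.source F W) :
    (WallFlow.psi Q 1 0 ∈ WallFlow.BSpace α (3 / 2 - δ) 2 ∧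
      WallFlow.psi Q 1 1 ∈ WallFlow.BSpace α (1 / 2) 3 ∧
      WallFlow.psi Q 2 0 ∈ WallFlow.BSpace α (5 / 2) 2 ∧
      WallFlow.psi Q 2 1 ∈ WallFlow.BSpace α (5 / 2) 3 ∧
      WallFlow.psi Q 3 0 ∈ WallFlow.BSpace α (5 / 2) 2 ∧
      WallFlow.psi Q 3 1 ∈ WallFlow.BSpace α (5 / 2) 3) ∧
    (WallFlow.phi Q 1 0 ∈ WallFlow.BSpace α (3 / 2 - δ) 2 ∧
      WallFlow.phi Q 1 1 ∈ WallFlow.BSpace α (1 / 2) 3 ∧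
      WallFlow.phi Q 2 0 ∈ WallFlow.BSpace α (5 / 2) 2 ∧
      WallFlow.phi Q 2 1 ∈ WallFlow.BSpace α (5 / 2) 3 ∧
      WallFlow.phi Q 3 0 ∈ WallFlow.BSpace α (5 / 2) 2 ∧
      WallFlow.phi Q 3 1 ∈ WallFlow.BSpace α (5 / 2) 3) ∧
    (WallFlow.omega Q 1 0 ∈ WallFlow.BSpace α (7 / 2) (3 - δ) ∧
      WallFlow.omega Q 1 1 ∈ WallFlow.BSpace α (5 / 2) 1 ∧
      WallFlow.omega Q 2 0 ∈ WallFlow.BSpaceInf α 3 ∧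
      WallFlow.omega Q 2 1 ∈ WallFlow.BSpace α (5 / 2) 3 ∧
      WallFlow.omega Q 3 0 ∈ WallFlow.BSpace α (7 / 2) 3 ∧
      WallFlow.omega Q 3 1 ∈ WallFlow.BSpace α (5 / 2) 3) ∧
    (WallFlow.eta Q 1 0 ∈ WallFlow.BSpace α (5 / 2) (2 - δ) ∧
      WallFlow.eta Q 1 1 ∈ WallFlow.BSpace α (3 / 2) 0 ∧
      WallFlow.eta Q 2 0 ∈ WallFlow.BSpaceInf α 2 ∧
      WallFlow.eta Q 2 1 ∈ WallFlow.BSpace α (5 / 2) 3 ∧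
      WallFlow.eta Q 3 0 ∈ WallFlow.BSpace α (5 / 2) 2 ∧
      WallFlow.eta Q 3 1 ∈ WallFlow.BSpace α (3 / 2) 2) := by
  have h0 : 0 ≤ α := by linarith
  obtain ⟨q0, q1⟩ := source_mem hα hF hW.1
  rw [← hQ] at q0 q1
  obtain ⟨θ, hθ0, hθ1, hθδ⟩ : ∃ θ : ℝ, 0 ≤ θ ∧ θ < 1 ∧ 1 - δ / 2 ≤ θ :=
    ⟨max (1 - δ / 2) 0, le_max_right _ _, max_lt (by linarith) one_pos, le_max_left _ _⟩
  have cont : ∀ n m, (n = 1 ∨ n = 2 ∨ n = 3) → (m = 0 ∨ m = 1) → _ :=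
    fun n m hn hm => kernel_continuousOn (n := n) (m := m) hn hm
  have h3 : (3 : ℝ) ≤ 4 := by norm_num
  have ha : ContinuousOn ak {0}ᶜ := continuous_ak.continuousOn
  have hκ := continuousOn_kappa
  refine ⟨⟨?_, ?_, ?_, ?_, ?_, ?_⟩, ⟨?_, ?_, ?_, ?_, ?_, ?_⟩, ⟨?_, ?_, ?_, ?_, ?_, ?_⟩,
    ⟨?_, ?_, ?_, ?_, ?_, ?_⟩⟩
  · exact head_ak_zero_mem h0 q0 hδ hθ0 hθ1 hθδ (cont 1 0 (by simp) (by simp)).2.2.1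
      fun _ _ _ => rfl
  · exact head_ak_one_mem h0 q1 (cont 1 1 (by simp) (by simp)).2.2.1 fun _ _ _ => rfl
  · exact tail_two_mem h0 le_rfl q0 ha ak_re_pos (cont 2 0 (by simp) (by simp)).2.2.1
      (fun _ _ hk hσ => norm_kerH_two_zero_le hk hσ) (by norm_num)
  · exact tail_two_mem h0 h3 q1 ha ak_re_pos (cont 2 1 (by simp) (by simp)).2.2.1
      (fun _ _ hk hσ => norm_kerH_two_one_le hk hσ) (by norm_num)
  · exact tail_three_mem h0 le_rfl q0 ha ak_re_pos (cont 3 0 (by simp) (by simp)).2.2.1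
      (fun k σ hk => by simp only [kerH, norm_mul, norm_neg, norm_ik_div_ak hk, one_mul, le_refl])
      (by norm_num)
  · exact tail_three_mem h0 h3 q1 ha ak_re_pos (cont 3 1 (by simp) (by simp)).2.2.1
      (fun k σ hk => le_rfl) (by norm_num)
  · exact head_ak_zero_mem h0 q0 hδ hθ0 hθ1 hθδ (cont 1 0 (by simp) (by simp)).2.2.2
      norm_kerK_one_zero
  · exact head_ak_one_mem h0 q1 (cont 1 1 (by simp) (by simp)).2.2.2 norm_kerK_one_one
  · exact tail_two_mem h0 le_rfl q0 ha ak_re_pos (cont 2 0 (by simp) (by simp)).2.2.2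
      (fun _ _ hk hσ => norm_kerK_two_zero_le hk hσ) (by norm_num)
  · exact tail_two_mem h0 h3 q1 ha ak_re_pos (cont 2 1 (by simp) (by simp)).2.2.2
      (fun _ _ hk hσ => norm_kerK_two_one_le hk hσ) (by norm_num)
  · exact tail_three_mem h0 le_rfl q0 ha ak_re_pos (cont 3 0 (by simp) (by simp)).2.2.2
      (fun k σ hk => by simp only [kerK, norm_neg, le_refl]) (by norm_num)
  · exact tail_three_mem h0 h3 q1 ha ak_re_pos (cont 3 1 (by simp) (by simp)).2.2.2
      (fun k σ hk => by simp only [kerK, norm_mul, norm_ak_div_ik hk, one_mul, le_refl])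
      (by norm_num)
  · exact omega_one_zero_mem h0 q0 hδ hθ0 hθ1 hθδ
  · exact omega_one_one_mem h0 q1
  · exact tail_two_mem_inf (a := 1) h0 zero_le_one q0 (cont 2 0 (by simp) (by simp)).1
      (fun k σ hk hσ => by rw [Real.rpow_one]; exact norm_kerF_two_zero_le hk hσ) (by norm_num)
  · exact tail_two_mem h0 h3 q1 hκ (fun _ => kappa_re_pos) (cont 2 1 (by simp) (by simp)).1
      (fun _ _ hk hσ => norm_kerF_two_one_le hk hσ) (by norm_num)
  · exact omega_three_zero_mem h0 q0
  · exact tail_three_mem h0 h3 q1 hκ (fun _ => kappa_re_pos) (cont 3 1 (by simp) (by simp)).1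
      (fun k σ hk => by simp only [kerF, norm_neg, le_refl]) (by norm_num)
  · exact eta_one_zero_mem h0 q0 hδ hθ0 hθ1 hθδ
  · exact eta_one_one_mem h0 q1
  · exact tail_two_mem_inf (a := 0) h0 le_rfl q0 (cont 2 0 (by simp) (by simp)).2.1
      (fun k σ hk hσ => by rw [Real.rpow_zero, one_mul]; exact norm_kerG_two_zero_le hk hσ)
      (by norm_num)
  · exact tail_two_mem h0 h3 q1 hκ (fun _ => kappa_re_pos) (cont 2 1 (by simp) (by simp)).2.1
      (fun _ _ hk hσ => norm_kerG_two_one_le hk hσ) (by norm_num)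
  · exact tail_three_mem h0 le_rfl q0 hκ (fun _ => kappa_re_pos) (cont 3 0 (by simp) (by simp)).2.1
      (fun k σ hk => by simp only [kerG, norm_neg, le_refl]) (by norm_num)
  · exact eta_three_one_mem h0 q1
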